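/- Let $n\ge 1$, $m$ be dimensions, $f:\mathbb R^n\to\mathbb R^n$, $h:\mathbb R^n\to\mathbb R^m$, and let $B\in\mathbb R^{n\times(n+m)}$, $D\in\mathbb R^{m\times(n+m)}$ have full row rank (nominal model $x_{t+1}=f(x_t)+Bv_t$, $y_t=h(x_t)+Dv_t$, $v_t$ standard white Gaussian noise). Let $\hat x_t\in\mathbb R^n$, $P_t>0$ be the prediction pair and let $c_t\ge 0$ be the tolerance. **Sigma points.** For $x\in\mathbb R^n$ and $P>0$ with a square root $\sqrt P$ ($\sqrt P\sqrt P^{\top}=P$), put $\sigma_i(x,P)=x+\sqrt P\,\lambda^i$, $i=1,\dots,p$, where the directions $\lambda^i$ and the weights $W_m^i,W_c^i$ are those of one of the following transformations ($e_k$ is the $k$-th unit vector). * Unscented, with $\lambda=a^2(\kappa+n)-n$ and $n+\lambda>0$: $\lambda^i=\pm\sqrt{\lambda+n}\,e_k$ with $W_m^i=W_c^i=\frac1{2(n+\lambda)}$, and $\lambda^{2n+1}=0$ with $W_m^{2n+1}=\frac{\lambda}{n+\lambda}$, $W_c^{2n+1}=\frac{\lambda}{n+\lambda}+1-a^2+b\ge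 0$. * Spherical cubature: $\lambda^i=\pm\sqrt n\,e_k$, $W_m^i=W_c^i=\frac1{2n}$. * Gauss–Hermite of order $q\ge1$: $\lambda^i$ runs over the vectors all of whose entries are roots of the (probabilists') Hermite polynomial $H_q$, and $W_m^i=W_c^i=\prod_{k=1}^n\frac{q!}{q^2H_{q-1}(\lambda^i_k)^2}$. **Gaussian approximation.** Let $\mathcal X^i=\sigma_i(\hat x_t,P_t)$, $m_y=\sum_iW_m^ih(\mathcal X^i)$, $K_y=\sum_iW_c^i(h(\mathcal X^i)-m_y)(h(\mathcal X^i)-m_y)^\top+DD^\top$, $K_{xy}=\sum_iW_c^i(\mathcal X^i-\hat x_t)(h(\mathcal X^i)-m_y)^\top$, and $$m_t=\begin{bmatrix}\hat x_t\\ m_y\end{bmatrix},\qquad K_t=\begin{bmatrix}P_t&K_{xy}\\K_{xy}^\top&K_y\end{bmatrix}.$$ **Minimax problem.** With $w=[x^\top\ y^\top]^\top$ and $\bar p=\mathcal N(m_t,K_t)$, let $\bar{\mathcal B}$ be the set of probability laws $\tilde p$ of $w$ whose Kullback–Leibler divergence satisfies $\mathcal D_{KL}(\tilde p,\bar p)\le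 c_t$, let $\mathcal G$ be the set of measurable $g:\mathbb R^m\to\mathbb R^n$ with $\int\|g(y)\|^2d\tilde p<\infty$ for all $\tilde p\in\bar{\mathcal B}$, and let $\bar J(\tilde p,g)=\frac12\int\|x-g(y)\|^2d\tilde p$. The robust estimator is the minimizer over $g\in\mathcal G$ of $\sup_{\tilde p\in\bar{\mathcal B}}\bar J(\tilde p,g)$. For $P>0$ and $\theta$ with $I-\theta P>0$ let $\gamma(P,\theta)=\frac12\big(\log\det(I-\theta P)+\operatorname{tr}((I-\theta P)^{-1}-I)\big)$. **Theorem.** 1. $K_t>0$. Moreover $\sum_iW_c^i\lambda^i(\lambda^i)^\top=I_n$ for each of the transformations, except Gauss–Hermite of order $q=1$. 2. The robust estimator exists, is unique up to Lebesgue-null sets, and is $$\hat x_{t|t}(y)=\hat x_t+K_{xy}K_y^{-1}(y-m_y).$$ 3. The covariance matrix of $x-\hat x_{t|t}(y)$ under $\bar p$ is $P_{t|t}=P_t-K_{xy}K_y^{-1}K_{xy}^\top>0$. 4. There is a unique $\theta_{t|t}\ge 0$ with $I-\theta_{t|t}P_{t|t}>0$ and $\gamma(P_{t|t},\theta_{t|t})=c_t$,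 and $\theta_{t|t}>0$ if $c_t>0$. With $\tilde P_{t|t}=(P_{t|t}^{-1}-\theta_{t|t}I)^{-1}>0$, the unique maximizer of $\bar J(\cdot,\hat x_{t|t})$ over $\bar{\mathcal B}$ (the least favorable law) is $\tilde p^\star=\mathcal N(m_t,\tilde K_t)$, where $\tilde K_t>0$ is $K_t$ with the block $P_t$ replaced by $\tilde P_{t|t}+K_{xy}K_y^{-1}K_{xy}^\top$. Furthermore $\bar J(\tilde p^\star,\hat x_{t|t})\le\bar J(\tilde p^\star,g)$ for all $g\in\mathcal G$, so $(\tilde p^\star,\hat x_{t|t})$ is a saddle point, and the covariance matrix of $x-\hat x_{t|t}(y)$ under $\tilde p^\star$ is $\tilde P_{t|t}$. 5. Under $\tilde p^\star$ the conditional law of $x$ given $y$ is, for almost every $y$, $\mathcal N(\hat x_{t|t}(y),\tilde P_{t|t})$. Hence the sigma-point approximation of the least favorable a priori law of $x_{t+1}=f(x_t)+Bv_t$ at the next stage is $\mathcal N(\hat x_{t+1},P_{t+1})$, where $\hat{\mathcal X}^i_{t+1}=f(\sigma_i(\hat x_{t|t},\tilde P_{t|t}))$, $\hat x_{t+1}=\sum_iW_m^i\hat{\mathcal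 X}^i_{t+1}$ and $P_{t+1}=\sum_iW_c^i(\hat{\mathcal X}^i_{t+1}-\hat x_{t+1})(\hat{\mathcal X}^i_{t+1}-\hat x_{t+1})^\top+BB^\top>0$. -/

import Mathlib

open MeasureTheory ProbabilityTheory
open scoped ENNReal

noncomputable section

namespace UpdateResilient

/-- `ℝⁿ` with its Euclidean norm. -/
abbrev Vec (n : ℕ) : Type := EuclideanSpace ℝ (Fin n)

/-- The space of the pairs `w = [x; y]` of a state `x ∈ ℝⁿ` and an observation `y ∈ ℝᵐ`. -/
abbrev Joint (n m : ℕ) : Type := EuclideanSpace ℝ (Fin n ⊕ Fin m)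

/-- The state component `x` of `w = [x; y]`. -/
def stateOf {n m : ℕ} (w : Joint n m) : Vec n := WithLp.toLp 2 fun i => w (Sum.inl i)

/-- The observation component `y` of `w = [x; y]`. -/
def obsOf {n m : ℕ} (w : Joint n m) : Vec m := WithLp.toLp 2 fun j => w (Sum.inr j)

/-- The vector `[x; y]`. -/
def stack {n m : ℕ} (x : Vec n) (y : Vec m) : Joint n m := WithLp.toLp 2 (Sum.elim x y)

/-- The matrix-vector product, as a map of Euclidean spaces. -/
def mv {k l : ℕ} (A : Matrix (Fin k) (Fin l) ℝ) (v : Vec l) : Vec k :=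
  WithLp.toLp 2 (A.mulVec v)

/-- The outer product `u vᵀ`. -/
def outer {k l : ℕ} (u : Vec k) (v : Vec l) : Matrix (Fin k) (Fin l) ℝ :=
  Matrix.vecMulVec u v

/-! ### Sigma points -/

/-- A sigma-point transformation in dimension `n`: a finite family of unit directions `λⁱ ∈ ℝⁿ`
with the weights for the mean and for the covariance. -/
structure SigmaRule (n : ℕ) where
  /-- the set of indices of the sigma points -/
  Idx : Type
  [fintypeIdx : Fintype Idx]
  /-- the directions `λⁱ` -/
  dir : Idx → Vec n
  /-- the weights for the mean -/
  wm : Idx → ℝ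
  /-- the weights for the covariance -/
  wc : Idx → ℝ

attribute [instance] SigmaRule.fintypeIdx

namespace SigmaRule

variable {n : ℕ}

/-- The sigma points `σᵢ(x, P) = x + S λⁱ`, where `S` is a square root of `P` (`S Sᵀ = P`). -/
def point (r : SigmaRule n) (x : Vec n) (S : Matrix (Fin n) (Fin n) ℝ) (i : r.Idx) : Vec n :=
  x + mv S (r.dir i)

/-- The matrix `Λ W Λᵀ = ∑ᵢ wcᵢ λⁱ (λⁱ)ᵀ`. -/
def secondMoment (r : SigmaRule n) : Matrix (Fin n) (Fin n) ℝ :=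
  ∑ i, r.wc i • outer (r.dir i) (r.dir i)

/-- The parameter `λ = a² (κ + n) - n` of the unscented transformation. -/
def unscentedLambda (n : ℕ) (a κ : ℝ) : ℝ := a ^ 2 * (κ + n) - n

/-- The unscented transformation with parameters `a, b, κ`: `2n + 1` points. -/
def unscented (n : ℕ) (a b κ : ℝ) : SigmaRule n where
  Idx := Fin n ⊕ Fin n ⊕ Unit
  dir := Sum.elim
    (fun i => √(unscentedLambda n a κ + n) • EuclideanSpace.single i (1 : ℝ))
    (Sum.elim
      (fun i => -(√(unscentedLambda n a κ + n) • EuclideanSpace.single i (1 : ℝ)))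
      (fun _ => 0))
  wm := Sum.elim
    (fun _ => 1 / (2 * (n + unscentedLambda n a κ)))
    (Sum.elim
      (fun _ => 1 / (2 * (n + unscentedLambda n a κ)))
      (fun _ => unscentedLambda n a κ / (n + unscentedLambda n a κ)))
  wc := Sum.elim
    (fun _ => 1 / (2 * (n + unscentedLambda n a κ)))
    (Sum.elim
      (fun _ => 1 / (2 * (n + unscentedLambda n a κ)))
      (fun _ => unscentedLambda n a κ / (n + unscentedLambda n a κ) + 1 - a ^ 2 + b))

/-- The spherical cubature transformation: `2n` points. -/
def cubature (n : ℕ) : SigmaRule n where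
  Idx := Fin n ⊕ Fin n
  dir := Sum.elim
    (fun i => √(n : ℝ) • EuclideanSpace.single i (1 : ℝ))
    (fun i => -(√(n : ℝ) • EuclideanSpace.single i (1 : ℝ)))
  wm := fun _ => 1 / (2 * n)
  wc := fun _ => 1 / (2 * n)

/-- The one-dimensional Gauss-Hermite weight `q! / (q² H_{q-1}(ν)²)`, where `H` denotes the
(probabilists') Hermite polynomials. -/
def hermiteWeight (q : ℕ) (ν : ℝ) : ℝ :=
  (q.factorial : ℝ) / ((q : ℝ) ^ 2 * (Polynomial.aeval ν (Polynomial.hermite (q - 1))) ^ 2)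

/-- The Gauss-Hermite transformation of order `q`: the directions are the vectors all of whose
entries are roots of the Hermite polynomial `H_q`. -/
def gaussHermite (n q : ℕ) : SigmaRule n where
  Idx := Fin n → (Polynomial.hermite q).rootSet ℝ
  dir := fun ν => WithLp.toLp 2 fun k => (ν k : ℝ)
  wm := fun ν => ∏ k, hermiteWeight q (ν k)
  wc := fun ν => ∏ k, hermiteWeight q (ν k)

/-- The three sigma-point transformations under consideration. For the unscented one the
parameters are such that the points are well defined (`n + λ = a² (κ + n) > 0`) and the
covariance weights are nonnegative (for the other two transformations they always are). -/
inductive IsStandard : SigmaRule n → Prop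
  | unscented (a b κ : ℝ) (hpos : 0 < a ^ 2 * (κ + n))
      (hwc : 0 ≤ unscentedLambda n a κ / (n + unscentedLambda n a κ) + 1 - a ^ 2 + b) :
      IsStandard (unscented n a b κ)
  | cubature : IsStandard (cubature n)
  | gaussHermite (q : ℕ) (hq : 1 ≤ q) : IsStandard (gaussHermite n q)

end SigmaRule

/-! ### Moments computed with the sigma points -/

section Moments

variable {n k : ℕ}

/-- `∑ᵢ wmᵢ φ(𝒳ⁱ)`, where `𝒳ⁱ` are the sigma points of `(x, S Sᵀ)`. -/
def sigmaMean (r : SigmaRule n) (φ : Vec n → Vec k) (x : Vec n) (S : Matrix (Fin n) (Fin n) ℝ) :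
    Vec k :=
  ∑ i, r.wm i • φ (r.point x S i)

/-- `∑ᵢ wcᵢ (φ(𝒳ⁱ) - μ) (φ(𝒳ⁱ) - μ)ᵀ + N Nᵀ` with `μ = sigmaMean`: the covariance of
`φ(x) + N v` with `v` standard white noise. -/
def sigmaCov {l : ℕ} (r : SigmaRule n) (φ : Vec n → Vec k) (N : Matrix (Fin k) (Fin l) ℝ)
    (x : Vec n) (S : Matrix (Fin n) (Fin n) ℝ) : Matrix (Fin k) (Fin k) ℝ :=
  ∑ i, r.wc i • outer (φ (r.point x S i) - sigmaMean r φ x S)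
      (φ (r.point x S i) - sigmaMean r φ x S) + N * N.transpose

/-- `∑ᵢ wcᵢ (𝒳ⁱ - x) (φ(𝒳ⁱ) - μ)ᵀ` with `μ = sigmaMean`. -/
def sigmaCross (r : SigmaRule n) (φ : Vec n → Vec k) (x : Vec n)
    (S : Matrix (Fin n) (Fin n) ℝ) : Matrix (Fin n) (Fin k) ℝ :=
  ∑ i, r.wc i • outer (r.point x S i - x) (φ (r.point x S i) - sigmaMean r φ x S)

end Moments

/-- `ν'` is the sigma-point approximation of the law of `f(x) + B v` when `x` has the Gaussian law
`ν` and `v` is independent standard white noise. -/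
def IsSigmaPrediction {n l : ℕ} (r : SigmaRule n) (f : Vec n → Vec n)
    (B : Matrix (Fin n) (Fin l) ℝ) (ν ν' : Measure (Vec n)) : Prop :=
  ∃ (x : Vec n) (P S : Matrix (Fin n) (Fin n) ℝ), P.PosDef ∧ S * S.transpose = P ∧
    ν = multivariateGaussian x P ∧
    ν' = multivariateGaussian (sigmaMean r f x S) (sigmaCov r f B x S)

/-! ### The minimax problem -/

section Minimax

variable {n m : ℕ}

/-- The ambiguity set: the probability laws of `w = [x; y]` whose Kullback-Leibler divergence from
the nominal law is at most `c`. (If the nominal law has a density, so do all of them.) -/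
def ball (pnom : Measure (Joint n m)) (c : ℝ) : Set (Measure (Joint n m)) :=
  {p | IsProbabilityMeasure p ∧ InformationTheory.klDiv p pnom ≤ ENNReal.ofReal c}

/-- The estimators `g(y)` of `x` with finite second moments under each law of the ambiguity
set. -/
def estimators (pnom : Measure (Joint n m)) (c : ℝ) : Set (Vec m → Vec n) :=
  {g | Measurable g ∧ ∀ p ∈ ball pnom c, MemLp (fun w => g (obsOf w)) 2 p}

/-- The objective `½ ∫ ‖x - g(y)‖² p(dw)`. -/
def cost (p : Measure (Joint n m)) (g : Vec m → Vec n) : ℝ≥0∞ :=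
  (1 / 2) * ∫⁻ w, ‖stateOf w - g (obsOf w)‖ₑ ^ 2 ∂p

/-- The worst-case value of the objective over the ambiguity set. -/
def worstCost (pnom : Measure (Joint n m)) (c : ℝ) (g : Vec m → Vec n) : ℝ≥0∞ :=
  ⨆ p ∈ ball pnom c, cost p g

/-- `g` solves the minimax problem. -/
def IsRobustEstimator (pnom : Measure (Joint n m)) (c : ℝ) (g : Vec m → Vec n) : Prop :=
  g ∈ estimators pnom c ∧ ∀ g' ∈ estimators pnom c, worstCost pnom c g ≤ worstCost pnom c g'

/-- `p` is a least favorable law for the estimator `g`: it attains the maximum of the objective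
over the ambiguity set. -/
def IsLeastFavorable (pnom : Measure (Joint n m)) (c : ℝ) (g : Vec m → Vec n)
    (p : Measure (Joint n m)) : Prop :=
  p ∈ ball pnom c ∧ ∀ p' ∈ ball pnom c, cost p' g ≤ cost p g

/-- The error `x - g(y)` is square integrable under `p`, with covariance matrix `C`. -/
def HasErrorCov (p : Measure (Joint n m)) (g : Vec m → Vec n) (C : Matrix (Fin n) (Fin n) ℝ) :
    Prop :=
  MemLp (fun w => stateOf w - g (obsOf w)) 2 p ∧
    ∀ i j, covariance (fun w => (stateOf w - g (obsOf w)) i)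
      (fun w => (stateOf w - g (obsOf w)) j) p = C i j

end Minimax

/-! ### The risk sensitivity parameter -/

/-- `γ(P, θ) = ½ (log det (I - θ P) + tr ((I - θ P)⁻¹ - I))`. -/
def gam {n : ℕ} (P : Matrix (Fin n) (Fin n) ℝ) (θ : ℝ) : ℝ :=
  1 / 2 * (Real.log (1 - θ • P).det + ((1 - θ • P)⁻¹ - 1).trace)

/-- `θ ≥ 0` solves `γ(P, θ) = c` in the domain `I - θ P > 0` of `γ(P, ·)`. -/
def IsRiskParam {n : ℕ} (P : Matrix (Fin n) (Fin n) ℝ) (c θ : ℝ) : Prop :=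
  0 ≤ θ ∧ (1 - θ • P).PosDef ∧ gam P θ = c

/-! ### The Gaussian approximation and the filter -/

section Filter

variable {n m l : ℕ}

/-- The mean `m_t = [x; m_y]` of the Gaussian approximation of the law of `w = [x; y]`. -/
def jointMean (r : SigmaRule n) (h : Vec n → Vec m) (x : Vec n)
    (S : Matrix (Fin n) (Fin n) ℝ) : Joint n m :=
  stack x (sigmaMean r h x S)

/-- The matrix `[A, K_xy; K_xyᵀ, K_y]`. For `A = P` it is the covariance matrix `K_t` of the
Gaussian approximation. -/
def jointCov (r : SigmaRule n) (h : Vec n → Vec m) (D : Matrix (Fin m) (Fin l) ℝ) (x : Vec n)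
    (S A : Matrix (Fin n) (Fin n) ℝ) : Matrix (Fin n ⊕ Fin m) (Fin n ⊕ Fin m) ℝ :=
  Matrix.fromBlocks A (sigmaCross r h x S) (sigmaCross r h x S).transpose (sigmaCov r h D x S)

/-- The gain `L = K_xy K_y⁻¹`. -/
def gain (r : SigmaRule n) (h : Vec n → Vec m) (D : Matrix (Fin m) (Fin l) ℝ) (x : Vec n)
    (S : Matrix (Fin n) (Fin n) ℝ) : Matrix (Fin n) (Fin m) ℝ :=
  sigmaCross r h x S * (sigmaCov r h D x S)⁻¹

/-- The a posteriori estimator `x + K_xy K_y⁻¹ (y - m_y)`, as a function of `y`. -/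
def postMean (r : SigmaRule n) (h : Vec n → Vec m) (D : Matrix (Fin m) (Fin l) ℝ) (x : Vec n)
    (S : Matrix (Fin n) (Fin n) ℝ) (y : Vec m) : Vec n :=
  x + mv (gain r h D x S) (y - sigmaMean r h x S)

/-- The nominal covariance `P_{t|t} = P - K_xy K_y⁻¹ K_xyᵀ`. -/
def postCov (r : SigmaRule n) (h : Vec n → Vec m) (D : Matrix (Fin m) (Fin l) ℝ) (x : Vec n)
    (S P : Matrix (Fin n) (Fin n) ℝ) : Matrix (Fin n) (Fin n) ℝ :=
  P - sigmaCross r h x S * (sigmaCov r h D x S)⁻¹ * (sigmaCross r h x S).transpose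

/-- The least favorable covariance `(C⁻¹ - θ I)⁻¹`. -/
def inflate (C : Matrix (Fin n) (Fin n) ℝ) (θ : ℝ) : Matrix (Fin n) (Fin n) ℝ :=
  (C⁻¹ - θ • 1)⁻¹

/-- The covariance matrix of the least favorable law of `w = [x; y]`, with upper left block
`(P_{t|t}⁻¹ - θ I)⁻¹ + K_xy K_y⁻¹ K_xyᵀ`. -/
def leastFavorableCov (r : SigmaRule n) (h : Vec n → Vec m) (D : Matrix (Fin m) (Fin l) ℝ)
    (x : Vec n) (S P : Matrix (Fin n) (Fin n) ℝ) (θ : ℝ) :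
    Matrix (Fin n ⊕ Fin m) (Fin n ⊕ Fin m) ℝ :=
  jointCov r h D x S (inflate (postCov r h D x S P) θ +
    sigmaCross r h x S * (sigmaCov r h D x S)⁻¹ * (sigmaCross r h x S).transpose)

/-- The nominal Gaussian law `N(m_t, K_t)` of `w = [x; y]`. -/
abbrev nominalLaw (r : SigmaRule n) (h : Vec n → Vec m) (D : Matrix (Fin m) (Fin l) ℝ)
    (x : Vec n) (S P : Matrix (Fin n) (Fin n) ℝ) : Measure (Joint n m) :=
  multivariateGaussian (jointMean r h x S) (jointCov r h D x S P)

/-- The least favorable Gaussian law of `w = [x; y]`. -/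
abbrev leastFavorableLaw (r : SigmaRule n) (h : Vec n → Vec m) (D : Matrix (Fin m) (Fin l) ℝ)
    (x : Vec n) (S P : Matrix (Fin n) (Fin n) ℝ) (θ : ℝ) : Measure (Joint n m) :=
  multivariateGaussian (jointMean r h x S) (leastFavorableCov r h D x S P θ)

end Filter

end UpdateResilient

end

open UpdateResilient

noncomputable section

namespace UpdateResilient

/-! ### Hermite polynomials and Gauss-Hermite quadrature -/

section Hermite

open Polynomial

/-! The minimax problem rests on one representation. By block elimination, the nominal Gaussian law
is the law of `[g(y) + e; y]`, where `g` is the affine estimator and `e`, independent of `y`, is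
centered Gaussian with the Schur complement `C` as covariance (`errorLaw`,
`multivariateGaussian_jointCov_add`). Tilting it by `exp (θ/2 ‖x - g(y)‖²)` touches only `e`: the
law of `y` and the independence survive, and `C` becomes `(C⁻¹ - θ I)⁻¹`. The divergence of the
tilted law from the nominal one is `γ(C, θ)`, so the equation for `θ` places it exactly at distance
`c`.

The Gibbs identity for the divergence from a tilted law then gives, for every `p` in the ball,
`KL(p, p⋆) + θ/2 E_p‖x - g(y)‖² ≤ θ/2 tr (C⁻¹ - θ I)⁻¹`. Hence the tilted law `p⋆` maximizes the
error of `g`, and equality forces `p = p⋆`. Conversely, under `p⋆` the error of `g` is still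
centered and independent of `y`, so any other estimator `g'` costs the extra term `½ E‖g - g'‖²`.
These two facts form the saddle point, from which minimax optimality and uniqueness follow; null
sets of the law of `y` are Lebesgue null because `K_y > 0`.

Diagonalizing `C` turns the equation for `θ` into a scalar one with a strictly increasing left side,
solved by the intermediate value theorem.

Positivity of the joint covariance needs only nonnegative weights and `∑ wcᵢ λⁱ (λⁱ)ᵀ ≤ I`: the
sigma-point moments then form a Gram matrix plus a positive semidefinite correction, and `D Dᵀ`
makes it definite. For Gauss-Hermite rules the second moment comes from Christoffel-Darboux at the
roots of `H_q`, which shows that the roots are real and simple and that the rule is exact on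
products of Hermite polynomials of degree below `q`. -/

lemma derivative_hermite_succ (k : ℕ) :
    derivative (hermite (k + 1)) = ((k + 1 : ℕ) : ℤ[X]) * hermite k := by
  induction k with
  | zero => simp [hermite_succ]
  | succ k ih =>
    have h2 : hermite (k + 1 + 1) = X * hermite (k + 1) - ((k + 1 : ℕ) : ℤ[X]) * hermite k := by
      rw [hermite_succ (k + 1), ih]
    have h1 := hermite_succ k
    rw [h2, derivative_sub, derivative_mul, derivative_mul, derivative_natCast, derivative_X, ih, h1]
    push_cast
    ring

lemma hermite_add_two (k : ℕ) :
    hermite (k + 2) = X * hermite (k + 1) - ((k + 1 : ℕ) : ℤ[X]) * hermite k := by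
  rw [hermite_succ (k + 1), derivative_hermite_succ]

variable {F : Type*} [Field F]

lemma aeval_hermite_add_two (k : ℕ) (x : F) :
    aeval x (hermite (k + 2)) = x * aeval x (hermite (k + 1)) - (k + 1) * aeval x (hermite k) := by
  rw [hermite_add_two]; simp

variable [CharZero F]

/-- The Christoffel-Darboux formula for the Hermite polynomials. -/
lemma christoffelDarboux_hermite (x y : F) (k : ℕ) :
    (x - y) * ∑ j ∈ Finset.range (k + 1), aeval x (hermite j) * aeval y (hermite j) / j.factorial =
      (aeval x (hermite (k + 1)) * aeval y (hermite k) -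
        aeval x (hermite k) * aeval y (hermite (k + 1))) / k.factorial := by
  induction k with
  | zero => simp
  | succ k ih =>
    rw [Finset.sum_range_succ, mul_add, ih, aeval_hermite_add_two, aeval_hermite_add_two,
      Nat.factorial_succ]
    have : (k.factorial : F) ≠ 0 := by exact_mod_cast k.factorial_ne_zero
    have : (k + 1 : F) ≠ 0 := by exact_mod_cast k.succ_ne_zero
    push_cast
    field_simp
    ring

/-- The Christoffel-Darboux formula for the Hermite polynomials on the diagonal. -/
lemma christoffelDarboux_hermite_self (x : F) (k : ℕ) :
    ∑ j ∈ Finset.range (k + 2), aeval x (hermite j) ^ 2 / (j.factorial : F) =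
      ((k + 2) * aeval x (hermite (k + 1)) ^ 2 -
        (k + 1) * (aeval x (hermite k) * aeval x (hermite (k + 2)))) / (k + 1).factorial := by
  induction k with
  | zero => simp [Finset.sum_range_succ, hermite_succ]; ring
  | succ k ih =>
    rw [Finset.sum_range_succ, ih, aeval_hermite_add_two (k + 1), aeval_hermite_add_two k,
      Nat.factorial_succ (k + 1), Nat.factorial_succ k]
    have : (k.factorial : F) ≠ 0 := by exact_mod_cast k.factorial_ne_zero
    have : (k + 1 : F) ≠ 0 := by exact_mod_cast k.succ_ne_zero
    have : (k + 1 + 1 : F) ≠ 0 := by exact_mod_cast (k + 1).succ_ne_zero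
    push_cast
    field_simp
    ring

/-- The right side is the reciprocal of the Gauss-Hermite weight: at a root of `H_q` only one term
of the diagonal Christoffel-Darboux formula survives. -/
lemma sum_sq_hermite_of_root {q : ℕ} (hq : 1 ≤ q) {x : F} (hx : aeval x (hermite q) = 0) :
    ∑ j ∈ Finset.range q, aeval x (hermite j) ^ 2 / (j.factorial : F) =
      q ^ 2 * aeval x (hermite (q - 1)) ^ 2 / q.factorial := by
  obtain _ | _ | q := q
  · omega
  · simp
  · rw [christoffelDarboux_hermite_self, hx, Nat.factorial_succ (q + 1)]
    have : ((q + 1).factorial : F) ≠ 0 := by exact_mod_cast (q + 1).factorial_ne_zero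
    have : (q + 1 + 1 : F) ≠ 0 := by exact_mod_cast (q + 1).succ_ne_zero
    simp only [Nat.add_sub_cancel]
    push_cast
    field_simp
    ring

lemma sum_hermite_mul_hermite_of_root {q : ℕ} {x y : F} (hxy : x ≠ y)
    (hx : aeval x (hermite q) = 0) (hy : aeval y (hermite q) = 0) :
    ∑ j ∈ Finset.range q, aeval x (hermite j) * aeval y (hermite j) / (j.factorial : F) = 0 := by
  obtain _ | q := q
  · simp
  · have := christoffelDarboux_hermite x y q
    rw [hx, hy] at this
    simpa [sub_ne_zero.2 hxy] using this

/-- The term `j = 0` is already `1`. With the closed form above, this keeps `H_{q-1}` from vanishing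
at a root of `H_q`. -/
lemma one_le_sum_sq_hermite {q : ℕ} (hq : 1 ≤ q) (x : ℝ) :
    1 ≤ ∑ j ∈ Finset.range q, aeval x (hermite j) ^ 2 / (j.factorial : ℝ) := by
  have := Finset.single_le_sum (f := fun j => aeval x (hermite j) ^ 2 / (j.factorial : ℝ))
    (fun j _ => by positivity) (Finset.mem_range.2 hq)
  simpa using this

/-- If `z` were not real, `z` and its conjugate would be distinct roots, and Christoffel-Darboux
would give `∑ |H_j(z)|² / j! = 0`, although the term `j = 0` equals `1`. -/
lemma hermite_root_im_eq_zero {q : ℕ} {z : ℂ} (hz : aeval z (hermite q) = 0) : z.im = 0 := by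
  by_contra him
  have hconj (j : ℕ) : aeval (starRingEnd ℂ z) (hermite j) = starRingEnd ℂ (aeval z (hermite j)) := by
    rw [aeval_def, aeval_def, hom_eval₂]
    congr 1
    exact RingHom.ext_int _ _
  have hne : z ≠ starRingEnd ℂ z := fun h => him (Complex.conj_eq_iff_im.1 h.symm)
  have hq : 1 ≤ q := by
    rcases Nat.eq_zero_or_pos q with rfl | h
    · simp at hz
    · exact h
  have h := sum_hermite_mul_hermite_of_root hne hz (by rw [hconj, hz, map_zero])
  have h2 : ((∑ j ∈ Finset.range q, ‖aeval z (hermite j)‖ ^ 2 / (j.factorial : ℝ) : ℝ) : ℂ) = 0 := by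
    rw [← h]
    push_cast
    refine Finset.sum_congr rfl fun j _ => ?_
    rw [hconj, Complex.mul_conj, Complex.normSq_eq_norm_sq]
    push_cast; rfl
  have h3 := Finset.single_le_sum (f := fun j => ‖aeval z (hermite j)‖ ^ 2 / (j.factorial : ℝ))
    (fun j _ => by positivity) (Finset.mem_range.2 hq)
  have h4 := Complex.ofReal_eq_zero.1 h2
  rw [h4] at h3
  norm_num at h3

lemma hermite_root_ne_zero {q : ℕ} (hq : 1 ≤ q) {x : ℝ} (hx : aeval x (hermite q) = 0) :
    aeval x (hermite (q - 1)) ≠ 0 := by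
  intro h
  have h1 := sum_sq_hermite_of_root hq hx
  have h2 := one_le_sum_sq_hermite hq x
  rw [h1, h] at h2
  norm_num at h2

/-- All complex roots are real, so `H_q` splits over `ℝ`; they are simple because `H_q' = q H_{q-1}`
does not vanish at them. -/
lemma card_rootSet_hermite {q : ℕ} (hq : 1 ≤ q) : Fintype.card ((hermite q).rootSet ℝ) = q := by
  have hs : ((hermite q).map (algebraMap ℤ ℝ)).Splits := by
    have hmon : ((hermite q).map (algebraMap ℤ ℝ)).Monic := (hermite_monic q).map _
    have hC : (((hermite q).map (algebraMap ℤ ℝ)).map (algebraMap ℝ ℂ)).Splits :=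
      IsAlgClosed.splits _
    refine hC.of_splits_map_of_injective (algebraMap ℝ ℂ).injective ?_
    intro z hz
    have hz' : aeval z (hermite q) = 0 := by
      have := (mem_roots'.1 hz).2
      rw [IsRoot, map_map, eval_map] at this
      rw [aeval_def, ← this]; congr 1
    exact ⟨z.re, Complex.ext (by simp) (by simp [hermite_root_im_eq_zero hz'])⟩
  have hmon : ((hermite q).map (algebraMap ℤ ℝ)).Monic := (hermite_monic q).map _
  have hnd : ((hermite q).map (algebraMap ℤ ℝ)).roots.Nodup := by
    rw [Multiset.nodup_iff_count_le_one]
    intro x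
    rw [count_roots]
    by_contra! hx
    rw [one_lt_rootMultiplicity_iff_isRoot hmon.ne_zero, derivative_map] at hx
    obtain ⟨h1, h2⟩ := hx
    rw [IsRoot, eval_map_algebraMap] at h1 h2
    refine hermite_root_ne_zero hq h1 ?_
    obtain ⟨k, rfl⟩ : ∃ k, q = k + 1 := ⟨q - 1, by omega⟩
    rw [derivative_hermite_succ, map_mul, map_natCast] at h2
    exact (mul_eq_zero.1 h2).resolve_left (by positivity)
  classical
  simp_rw [rootSet_def, Finset.coe_sort_coe, Fintype.card_coe]
  rw [Multiset.toFinset_card_of_nodup hnd, ← hs.natDegree_eq_card_roots,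
    (hermite_monic q).natDegree_map, natDegree_hermite]

/-- Gauss-Hermite quadrature of order `q` is exact on the products of two normalized Hermite
polynomials of degrees less than `q`. -/
lemma sum_hermiteWeight_mul {q : ℕ} {j k : ℕ} (hj : j < q) (hk : k < q) :
    ∑ x : (hermite q).rootSet ℝ, SigmaRule.hermiteWeight q x *
      (aeval (x : ℝ) (hermite j) * aeval (x : ℝ) (hermite k)) = if j = k then (j.factorial : ℝ) else 0 := by
  have hq : 1 ≤ q := by omega
  have hroot (x : (hermite q).rootSet ℝ) : aeval (x : ℝ) (hermite q) = 0 := (mem_rootSet.1 x.2).2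
  have hw (x : (hermite q).rootSet ℝ) : SigmaRule.hermiteWeight q x *
      ∑ j ∈ Finset.range q, aeval (x : ℝ) (hermite j) ^ 2 / (j.factorial : ℝ) = 1 := by
    have h1 := hermite_root_ne_zero hq (hroot x)
    have h2 : (q : ℝ) ≠ 0 := by positivity
    have h3 : (q.factorial : ℝ) ≠ 0 := by positivity
    rw [sum_sq_hermite_of_root hq (hroot x), SigmaRule.hermiteWeight]
    field_simp
  -- Christoffel-Darboux at pairs of roots says `V * U = 1`. There are exactly `q` roots, so the
  -- matrices are square and `U * V = 1` too, which is the discrete orthogonality of the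
  -- polynomials.
  let V : Matrix ((hermite q).rootSet ℝ) (Fin q) ℝ := fun x j =>
    SigmaRule.hermiteWeight q x * aeval (x : ℝ) (hermite j)
  let U : Matrix (Fin q) ((hermite q).rootSet ℝ) ℝ := fun j x =>
    aeval (x : ℝ) (hermite j) / (j : ℕ).factorial
  have hVU : V * U = 1 := by
    ext x y
    have : (V * U) x y = SigmaRule.hermiteWeight q x * ∑ j ∈ Finset.range q,
        aeval (x : ℝ) (hermite j) * aeval (y : ℝ) (hermite j) / (j.factorial : ℝ) := by
      rw [Matrix.mul_apply, ← Fin.sum_univ_eq_sum_range (fun j => aeval (x : ℝ) (hermite j) *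
        aeval (y : ℝ) (hermite j) / (j.factorial : ℝ)), Finset.mul_sum]
      exact Finset.sum_congr rfl fun j _ => by simp only [V, U]; ring
    rw [this]
    by_cases hxy : x = y
    · subst hxy
      rw [Matrix.one_apply_eq, ← hw x]
      simp_rw [pow_two]
    · rw [Matrix.one_apply_ne hxy, sum_hermite_mul_hermite_of_root (fun h => hxy (Subtype.ext h))
        (hroot x) (hroot y), mul_zero]
  have hUV : U * V = 1 := by
    refine (Matrix.mul_eq_one_comm_of_card_eq _ _ _ ?_).1 hVU
    rw [card_rootSet_hermite hq, Fintype.card_fin]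
  have h := congrFun (congrFun hUV ⟨j, hj⟩) ⟨k, hk⟩
  rw [Matrix.mul_apply, Matrix.one_apply] at h
  have hf : (j.factorial : ℝ) ≠ 0 := by positivity
  have h' : ∑ x : (hermite q).rootSet ℝ, SigmaRule.hermiteWeight q x *
      (aeval (x : ℝ) (hermite j) * aeval (x : ℝ) (hermite k)) =
      j.factorial * ∑ x, U ⟨j, hj⟩ x * V x ⟨k, hk⟩ := by
    rw [Finset.mul_sum]
    refine Finset.sum_congr rfl fun x _ => ?_
    simp only [U, V]
    field_simp
  rw [h', h]
  by_cases hjk : j = k <;> simp [hjk]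

lemma sum_hermiteWeight {q : ℕ} (hq : 1 ≤ q) :
    ∑ x : (hermite q).rootSet ℝ, SigmaRule.hermiteWeight q x = 1 := by
  simpa using sum_hermiteWeight_mul (j := 0) (k := 0) hq hq

lemma sum_hermiteWeight_mul_self {q : ℕ} (hq : 2 ≤ q) :
    ∑ x : (hermite q).rootSet ℝ, SigmaRule.hermiteWeight q x * (x : ℝ) = 0 := by
  simpa using sum_hermiteWeight_mul (q := q) (j := 0) (k := 1) (by omega) (by omega)

lemma sum_hermiteWeight_mul_sq {q : ℕ} (hq : 2 ≤ q) :
    ∑ x : (hermite q).rootSet ℝ, SigmaRule.hermiteWeight q x * ((x : ℝ) * x) = 1 := by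
  simpa using sum_hermiteWeight_mul (q := q) (j := 1) (k := 1) (by omega) (by omega)

end Hermite

/-! ### The second-moment identity -/

namespace SigmaRule

variable {n : ℕ}

lemma outer_apply {k l : ℕ} (u : Vec k) (v : Vec l) (i : Fin k) (j : Fin l) :
    outer u v i j = u i * v j := rfl

lemma secondMoment_apply (r : SigmaRule n) (i j : Fin n) :
    r.secondMoment i j = ∑ ν, r.wc ν * (r.dir ν i * r.dir ν j) := by
  simp [secondMoment, Matrix.sum_apply, outer_apply]

/-- The product weights factor each entry into one-dimensional moments of orders `0`, `1` and `2`;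
the last two are exact only from `q = 2` on. -/
lemma secondMoment_gaussHermite {q : ℕ} (hq : 2 ≤ q) : (gaussHermite n q).secondMoment = 1 := by
  ext i j
  rw [secondMoment_apply]
  let g (k : Fin n) (x : (Polynomial.hermite q).rootSet ℝ) : ℝ :=
    hermiteWeight q x * ((if k = i then (x : ℝ) else 1) * (if k = j then (x : ℝ) else 1))
  have h1 : ∑ ν : Fin n → (Polynomial.hermite q).rootSet ℝ,
      (∏ k, hermiteWeight q (ν k)) * ((ν i : ℝ) * (ν j : ℝ)) = ∏ k, ∑ x, g k x := by
    rw [Finset.prod_univ_sum, Fintype.piFinset_univ]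
    refine Finset.sum_congr rfl fun ν _ => ?_
    simp only [g, Finset.prod_mul_distrib]
    simp
  refine Eq.trans h1 ?_
  by_cases hij : i = j
  · subst hij
    rw [Matrix.one_apply_eq]
    refine Finset.prod_eq_one fun k _ => ?_
    by_cases hk : k = i
    · simpa [g, hk] using sum_hermiteWeight_mul_sq hq
    · simpa [g, hk] using sum_hermiteWeight (by omega : 1 ≤ q)
  · rw [Matrix.one_apply_ne hij]
    refine Finset.prod_eq_zero (Finset.mem_univ i) ?_
    simpa [g, hij] using sum_hermiteWeight_mul_self hq

lemma secondMoment_gaussHermite_one : (gaussHermite n 1).secondMoment = 0 := by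
  ext i j
  rw [secondMoment_apply]
  refine Finset.sum_eq_zero fun ν _ => ?_
  have h : ((ν i : ℝ)) = 0 := by
    have := (Polynomial.mem_rootSet.1 (ν i).2).2
    simpa using this
  have h' : (gaussHermite n 1).dir ν i = 0 := h
  rw [h', zero_mul, mul_zero]

lemma sum_single_mul_single (s : ℝ) (i j : Fin n) :
    ∑ k, (s • EuclideanSpace.single k (1 : ℝ) : Vec n) i *
      (s • EuclideanSpace.single k (1 : ℝ) : Vec n) j = s ^ 2 * (1 : Matrix (Fin n) (Fin n) ℝ) i j := by
  simp [Matrix.one_apply, pow_two]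

lemma secondMoment_unscented {a b κ : ℝ} (h : 0 < a ^ 2 * (κ + n)) :
    (unscented n a b κ).secondMoment = 1 := by
  have h1 : unscentedLambda n a κ + n = a ^ 2 * (κ + n) := by rw [unscentedLambda]; ring
  have h2 : (n : ℝ) + unscentedLambda n a κ = a ^ 2 * (κ + n) := by rw [unscentedLambda]; ring
  ext i j
  have h3 := sum_single_mul_single (√(a ^ 2 * (κ + n))) i j
  rw [Real.sq_sqrt h.le] at h3
  rw [secondMoment_apply]
  refine (Fintype.sum_sum_type _).trans ?_
  rw [Fintype.sum_sum_type]
  simp only [unscented, Sum.elim_inl, Sum.elim_inr, h1, h2, PiLp.neg_apply,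
    neg_mul_neg, ← Finset.mul_sum, h3]
  have := h.ne'
  generalize a ^ 2 * (κ + n) = s at *
  simp only [PiLp.zero_apply, mul_zero, Finset.sum_const_zero, add_zero]
  field_simp
  ring

lemma secondMoment_cubature (hn : 0 < n) : (cubature n).secondMoment = 1 := by
  ext i j
  have h3 := sum_single_mul_single (√(n : ℝ)) i j
  rw [Real.sq_sqrt (by positivity)] at h3
  rw [secondMoment_apply]
  refine (Fintype.sum_sum_type _).trans ?_
  simp only [cubature, Sum.elim_inl, Sum.elim_inr, PiLp.neg_apply,
    neg_mul_neg, ← Finset.mul_sum, h3]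
  have : (n : ℝ) ≠ 0 := by positivity
  field_simp
  ring

lemma IsStandard.secondMoment_eq_one {r : SigmaRule n} (hr : r.IsStandard) (hn : 0 < n)
    (h : r ≠ SigmaRule.gaussHermite n 1) : r.secondMoment = 1 := by
  cases hr with
  | unscented a b κ hpos _ => exact secondMoment_unscented hpos
  | cubature => exact secondMoment_cubature hn
  | gaussHermite q hq =>
    refine secondMoment_gaussHermite (lt_of_le_of_ne hq ?_)
    rintro rfl
    exact h rfl

/-- This inequality replaces the second-moment identity in the positivity proof, so that
Gauss-Hermite of order `1`, whose second moment is `0`, is covered as well. -/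
lemma IsStandard.posSemidef_one_sub {r : SigmaRule n} (hr : r.IsStandard) (hn : 0 < n) :
    (1 - r.secondMoment).PosSemidef := by
  by_cases h : r = SigmaRule.gaussHermite n 1
  · rw [h, secondMoment_gaussHermite_one, sub_zero]
    exact Matrix.PosSemidef.one
  · rw [hr.secondMoment_eq_one hn h, sub_self]
    exact Matrix.PosSemidef.zero

lemma IsStandard.wc_nonneg {r : SigmaRule n} (hr : r.IsStandard) (ν : r.Idx) : 0 ≤ r.wc ν := by
  cases hr with
  | unscented a b κ hpos hwc =>
    have h2 : (n : ℝ) + unscentedLambda n a κ = a ^ 2 * (κ + n) := by rw [unscentedLambda]; ring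
    have h3 : 0 ≤ 1 / (2 * ((n : ℝ) + unscentedLambda n a κ)) := by rw [h2]; positivity
    rcases ν with ν | ν | ν
    · exact h3
    · exact h3
    · exact hwc
  | cubature => simp only [SigmaRule.cubature]; positivity
  | gaussHermite q hq =>
    simp only [SigmaRule.gaussHermite, hermiteWeight]
    exact Finset.prod_nonneg fun k _ => by positivity

end SigmaRule

/-! ### Positive definiteness of the covariance matrices -/

section PosDef

open Matrix

lemma posDef_mul_transpose_of_rank {k l : ℕ} {N : Matrix (Fin k) (Fin l) ℝ} (hN : N.rank = k) :
    (N * N.transpose).PosDef := by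
  have h : LinearIndependent ℝ N.row := by
    rw [linearIndependent_iff_card_eq_finrank_span, Fintype.card_fin, Set.finrank,
      ← rank_eq_finrank_span_row, hN]
  have := PosDef.mul_conjTranspose_self N (vecMul_injective_iff.2 h)
  rwa [conjTranspose_eq_transpose_of_trivial] at this

lemma posSemidef_sum_outer {ι κ : Type*} [Fintype ι] [Finite κ] {c : ι → ℝ} (hc : ∀ i, 0 ≤ c i)
    (u : ι → κ → ℝ) : (∑ i, c i • vecMulVec (u i) (u i)).PosSemidef :=
  posSemidef_sum _ fun i _ => (posSemidef_vecMulVec_self_star (u i)).smul (hc i)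

variable {α β : Type*} [Fintype α] [Fintype β]

lemma dotProduct_fromBlocks_mulVec (A : Matrix α α ℝ) (X : Matrix α β ℝ) (Y : Matrix β α ℝ)
    (Z : Matrix β β ℝ) (a : α → ℝ) (b : β → ℝ) :
    Sum.elim a b ⬝ᵥ fromBlocks A X Y Z *ᵥ Sum.elim a b =
      a ⬝ᵥ (A *ᵥ a + X *ᵥ b) + b ⬝ᵥ (Y *ᵥ a + Z *ᵥ b) := by
  rw [fromBlocks_mulVec, sumElim_dotProduct_sumElim]
  rfl

/-- On a vector `[a; b]` with `b ≠ 0` the block `N` makes the quadratic form positive; if `b = 0`,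
then `a ≠ 0` and `A` does. -/
lemma posDef_fromBlocks_of_posSemidef {A : Matrix α α ℝ} {X : Matrix α β ℝ} {Z N : Matrix β β ℝ}
    (hA : A.PosDef) (hN : N.PosDef) (h : (fromBlocks A X X.transpose (Z - N)).PosSemidef) :
    (fromBlocks A X X.transpose Z).PosDef := by
  have hK : fromBlocks A X X.transpose Z =
      fromBlocks A X X.transpose (Z - N) + fromBlocks 0 0 0 N := by simp [fromBlocks_add]
  refine PosDef.of_dotProduct_mulVec_pos ?_ fun w hw => ?_
  · rw [hK]
    refine h.1.add ?_
    exact isHermitian_fromBlocks_iff.2 ⟨isHermitian_zero, by simp, by simp, hN.1⟩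
  · obtain ⟨a, b, rfl⟩ : ∃ a b, w = Sum.elim a b := ⟨_, _, (Sum.elim_comp_inl_inr w).symm⟩
    rw [star_trivial]
    by_cases hb : b = 0
    · subst hb
      have ha : a ≠ 0 := fun ha => hw (by subst ha; ext i; cases i <;> rfl)
      rw [dotProduct_fromBlocks_mulVec]
      simpa using hA.dotProduct_mulVec_pos ha
    · have h1 := h.dotProduct_mulVec_nonneg (Sum.elim a b)
      have h2 := hN.dotProduct_mulVec_pos hb
      rw [star_trivial] at h1 h2
      rw [hK, add_mulVec, dotProduct_add]
      refine add_pos_of_nonneg_of_pos h1 ?_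
      rw [dotProduct_fromBlocks_mulVec]
      simpa using h2

variable [DecidableEq α] [DecidableEq β]

/-- The Schur complement criterion for positive definiteness. -/
lemma posDef_fromBlocks_iff {A : Matrix α α ℝ} {X : Matrix α β ℝ} {Z : Matrix β β ℝ}
    (hZ : Z.PosDef) :
    (fromBlocks A X X.transpose Z).PosDef ↔ (A - X * Z⁻¹ * X.transpose).PosDef := by
  have := hZ.isUnit.invertible
  have h1 : (fromBlocks A X X.transpose Z).PosSemidef ↔
      (A - X * Z⁻¹ * X.transpose).PosSemidef := by
    simpa only [conjTranspose_eq_transpose_of_trivial] using PosDef.fromBlocks₂₂ A X hZ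
  have h2 : (fromBlocks A X X.transpose Z).det ≠ 0 ↔ (A - X * Z⁻¹ * X.transpose).det ≠ 0 := by
    rw [det_fromBlocks₂₂, invOf_eq_nonsing_inv, mul_ne_zero_iff]
    exact and_iff_right hZ.det_pos.ne'
  constructor
  · intro h
    exact (h1.1 h.posSemidef).posDef_iff_det_ne_zero.2 (h2.1 h.det_pos.ne')
  · intro h
    exact (h1.2 h.posSemidef).posDef_iff_det_ne_zero.2 (h2.2 h.det_pos.ne')

end PosDef

section SigmaPosDef

variable {n m l : ℕ} {r : SigmaRule n}

lemma sigmaCov_posDef (hr : r.IsStandard) (φ : Vec n → Vec m) {N : Matrix (Fin m) (Fin l) ℝ}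
    (hN : N.rank = m) (x : Vec n) (S : Matrix (Fin n) (Fin n) ℝ) :
    (sigmaCov r φ N x S).PosDef :=
  Matrix.PosDef.posSemidef_add (posSemidef_sum_outer hr.wc_nonneg _)
    (posDef_mul_transpose_of_rank hN)

lemma outer_mv (S : Matrix (Fin n) (Fin n) ℝ) (u v : Vec n) :
    outer (mv S u) (mv S v) = S * outer u v * S.transpose := by
  rw [outer, outer, Matrix.mul_vecMulVec, Matrix.vecMulVec_mul, Matrix.vecMul_transpose]
  rfl

lemma jointCov_posDef (hr : r.IsStandard) (hn : 0 < n) (h : Vec n → Vec m)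
    {D : Matrix (Fin m) (Fin l) ℝ} (hD : D.rank = m) (x : Vec n) {P S : Matrix (Fin n) (Fin n) ℝ}
    (hP : P.PosDef) (hS : S * S.transpose = P) : (jointCov r h D x S P).PosDef := by
  refine posDef_fromBlocks_of_posSemidef hP (posDef_mul_transpose_of_rank hD) ?_
  let u (i : r.Idx) : Fin n ⊕ Fin m → ℝ :=
    Sum.elim (r.point x S i - x) (h (r.point x S i) - sigmaMean r h x S)
  -- Without `D Dᵀ` the joint matrix is a weighted Gram matrix of the stacked deviations, except
  -- that the sigma points reproduce `S Λ W Λᵀ Sᵀ` instead of `P`; the defect sits in the state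
  -- block.
  have hK : Matrix.fromBlocks P (sigmaCross r h x S) (sigmaCross r h x S).transpose
      (sigmaCov r h D x S - D * D.transpose) =
      ∑ i, r.wc i • Matrix.vecMulVec (u i) (u i) +
        Matrix.fromBlocks (S * (1 - r.secondMoment) * S.transpose) 0 0 0 := by
    have h1 : P = ∑ i, r.wc i • outer (r.point x S i - x) (r.point x S i - x) +
        S * (1 - r.secondMoment) * S.transpose := by
      have : ∑ i, r.wc i • outer (r.point x S i - x) (r.point x S i - x) =
          S * r.secondMoment * S.transpose := by
        simp only [SigmaRule.point, add_sub_cancel_left, outer_mv, SigmaRule.secondMoment,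
          Finset.mul_sum, Finset.sum_mul, Matrix.mul_smul, Matrix.smul_mul]
      rw [this, mul_sub, mul_one, sub_mul, hS]
      abel
    ext i j
    rcases i with i | i <;> rcases j with j | j
    · simpa [Matrix.sum_apply, u, Matrix.vecMulVec_apply, SigmaRule.outer_apply] using
        congrFun (congrFun h1 i) j
    · simp [Matrix.sum_apply, u, Matrix.vecMulVec_apply, SigmaRule.outer_apply, sigmaCross]
    · simp [Matrix.sum_apply, u, Matrix.vecMulVec_apply, SigmaRule.outer_apply, sigmaCross,
        mul_comm]
    · simp [Matrix.sum_apply, u, Matrix.vecMulVec_apply, SigmaRule.outer_apply, sigmaCov]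
  rw [hK]
  refine (posSemidef_sum_outer hr.wc_nonneg u).add ?_
  have h2 : (S * (1 - r.secondMoment) * S.transpose).PosSemidef := by
    have := (hr.posSemidef_one_sub hn).mul_mul_conjTranspose_same S
    rwa [Matrix.conjTranspose_eq_transpose_of_trivial] at this
  -- Padding a block by zeros is a congruence with `[1 0]`, which preserves semidefiniteness.
  have h3 := h2.conjTranspose_mul_mul_same (Matrix.fromCols 1 0 : Matrix (Fin n) (Fin n ⊕ Fin m) ℝ)
  convert! h3 using 1
  ext i j
  rcases i with i | i <;> rcases j with j | j <;>
    simp [Matrix.transpose_fromCols, Matrix.fromRows_mul, Matrix.mul_fromCols]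

end SigmaPosDef

/-! ### Spectral computations -/

section Spectral

open Matrix

variable {n : ℕ}

lemma exists_orthogonal_diagonalization {C : Matrix (Fin n) (Fin n) ℝ} (hC : C.PosDef) :
    ∃ (U : Matrix (Fin n) (Fin n) ℝ) (d : Fin n → ℝ), U * U.transpose = 1 ∧
      U.transpose * U = 1 ∧ (∀ i, 0 < d i) ∧ C = U * diagonal d * U.transpose := by
  refine ⟨hC.1.eigenvectorUnitary, hC.1.eigenvalues, ?_, ?_, hC.eigenvalues_pos, ?_⟩
  · exact Unitary.coe_mul_star_self hC.1.eigenvectorUnitary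
  · exact Unitary.coe_star_mul_self hC.1.eigenvectorUnitary
  · have := hC.1.spectral_theorem
    rw [Unitary.conjStarAlgAut_apply] at this
    exact this

variable {U : Matrix (Fin n) (Fin n) ℝ} {d : Fin n → ℝ}

lemma one_sub_smul_conj_diagonal (hU : U * U.transpose = 1) (θ : ℝ) :
    1 - θ • (U * diagonal d * U.transpose) =
      U * diagonal (fun i => 1 - θ * d i) * U.transpose := by
  have : diagonal (fun i => 1 - θ * d i) = 1 - θ • diagonal d := by
    ext i j; by_cases h : i = j <;> simp [h, one_apply]
  rw [this, mul_sub, sub_mul, mul_one, hU, Matrix.mul_smul, Matrix.smul_mul]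

lemma inv_conj_diagonal (hU : U * U.transpose = 1) (hU' : U.transpose * U = 1)
    (hd : ∀ i, d i ≠ 0) :
    (U * diagonal d * U.transpose)⁻¹ = U * diagonal (fun i => (d i)⁻¹) * U.transpose := by
  refine inv_eq_right_inv ?_
  have : diagonal d * diagonal (fun i => (d i)⁻¹) = 1 := by
    rw [diagonal_mul_diagonal, ← diagonal_one]
    congr 1; ext i; exact mul_inv_cancel₀ (hd i)
  calc U * diagonal d * U.transpose * (U * diagonal (fun i => (d i)⁻¹) * U.transpose)
      = U * diagonal d * (U.transpose * U) * diagonal (fun i => (d i)⁻¹) * U.transpose := by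
        simp only [mul_assoc]
    _ = U * (diagonal d * diagonal (fun i => (d i)⁻¹)) * U.transpose := by
        rw [hU', mul_one]; simp only [mul_assoc]
    _ = 1 := by rw [this, mul_one, hU]

lemma posDef_conj_diagonal_iff (hU : U * U.transpose = 1) :
    (U * diagonal d * U.transpose).PosDef ↔ ∀ i, 0 < d i := by
  have hunit : IsUnit U := IsUnit.of_mul_eq_one _ hU
  have := hunit.posDef_star_right_conjugate_iff (x := diagonal d)
  rw [star_eq_conjTranspose, conjTranspose_eq_transpose_of_trivial] at this
  rw [this, posDef_diagonal_iff]

lemma det_conj_diagonal (hU : U * U.transpose = 1) :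
    (U * diagonal d * U.transpose).det = ∏ i, d i := by
  rw [det_mul, det_mul, det_diagonal, mul_right_comm, ← det_mul, hU, det_one, one_mul]

lemma trace_conj_diagonal (hU' : U.transpose * U = 1) :
    (U * diagonal d * U.transpose).trace = ∑ i, d i := by
  rw [trace_mul_comm, ← mul_assoc, hU', one_mul, trace_diagonal]

lemma posDef_one_sub_iff (hU : U * U.transpose = 1) (θ : ℝ) :
    (1 - θ • (U * diagonal d * U.transpose)).PosDef ↔ ∀ i, 0 < 1 - θ * d i := by
  rw [one_sub_smul_conj_diagonal hU, posDef_conj_diagonal_iff hU]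

lemma det_one_sub (hU : U * U.transpose = 1) (θ : ℝ) :
    (1 - θ • (U * diagonal d * U.transpose)).det = ∏ i, (1 - θ * d i) := by
  rw [one_sub_smul_conj_diagonal hU, det_conj_diagonal hU]

lemma gam_conj_diagonal (hU : U * U.transpose = 1) (hU' : U.transpose * U = 1) {θ : ℝ}
    (hθ : ∀ i, 0 < 1 - θ * d i) :
    gam (U * diagonal d * U.transpose) θ =
      1 / 2 * ∑ i, (Real.log (1 - θ * d i) + ((1 - θ * d i)⁻¹ - 1)) := by
  rw [gam, det_one_sub hU, one_sub_smul_conj_diagonal hU,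
    inv_conj_diagonal hU hU' fun i => (hθ i).ne', trace_sub, trace_conj_diagonal hU',
    Real.log_prod fun i _ => (hθ i).ne', Finset.sum_add_distrib, Finset.sum_sub_distrib]
  simp

lemma inflate_conj_diagonal (hU : U * U.transpose = 1) (hU' : U.transpose * U = 1)
    (hd : ∀ i, 0 < d i) {θ : ℝ} (hθ : ∀ i, 0 < 1 - θ * d i) :
    inflate (U * diagonal d * U.transpose) θ =
      U * diagonal (fun i => d i * (1 - θ * d i)⁻¹) * U.transpose := by
  have h1 : (fun i => (d i)⁻¹ - θ) = fun i => (1 - θ * d i) / d i := by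
    ext i; have := (hd i).ne'; field_simp
  have h2 : diagonal (fun i => (d i)⁻¹ - θ) = diagonal (fun i => (d i)⁻¹) - θ • 1 := by
    ext i j; by_cases h : i = j <;> simp [h, one_apply]
  have h3 : U * diagonal (fun i => (d i)⁻¹) * U.transpose - θ • 1 =
      U * diagonal (fun i => (1 - θ * d i) / d i) * U.transpose := by
    rw [← h1, h2, mul_sub, sub_mul, Matrix.mul_smul, Matrix.smul_mul, mul_one, hU]
  rw [inflate, inv_conj_diagonal hU hU' fun i => (hd i).ne', h3, inv_conj_diagonal hU hU']
  · simp only [inv_div]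
    simp only [div_eq_mul_inv]
  · exact fun i => (div_pos (hθ i) (hd i)).ne'

lemma inflate_posDef {C : Matrix (Fin n) (Fin n) ℝ} (hC : C.PosDef) {θ : ℝ}
    (hθ : (1 - θ • C).PosDef) : (inflate C θ).PosDef := by
  obtain ⟨U, d, hU, hU', hd, rfl⟩ := exists_orthogonal_diagonalization hC
  rw [posDef_one_sub_iff hU] at hθ
  rw [inflate_conj_diagonal hU hU' hd hθ, posDef_conj_diagonal_iff hU]
  exact fun i => mul_pos (hd i) (inv_pos.2 (hθ i))

/-- The function `γ` in terms of the covariance matrix `(C⁻¹ - θ I)⁻¹`. -/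
lemma gam_eq_trace_inflate {C : Matrix (Fin n) (Fin n) ℝ} (hC : C.PosDef) {θ : ℝ}
    (hθ : (1 - θ • C).PosDef) :
    gam C θ = θ / 2 * (inflate C θ).trace + 1 / 2 * Real.log (1 - θ • C).det := by
  obtain ⟨U, d, hU, hU', hd, rfl⟩ := exists_orthogonal_diagonalization hC
  rw [posDef_one_sub_iff hU] at hθ
  rw [inflate_conj_diagonal hU hU' hd hθ, trace_conj_diagonal hU', gam_conj_diagonal hU hU' hθ,
    det_one_sub hU, Real.log_prod fun i _ => (hθ i).ne', Finset.mul_sum, Finset.mul_sum, Finset.mul_sum,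
    ← Finset.sum_add_distrib]
  refine Finset.sum_congr rfl fun i _ => ?_
  have := (hθ i).ne'
  field_simp
  ring

/-! ### The risk sensitivity parameter -/

lemma strictMonoOn_log_add_inv :
    StrictMonoOn (fun u : ℝ => Real.log (1 - u) + ((1 - u)⁻¹ - 1)) (Set.Ico 0 1) := by
  intro u hu v hv huv
  have hu1 : 0 < 1 - u := by linarith [hu.2]
  have hv1 : 0 < 1 - v := by linarith [hv.2]
  -- The increment of the logarithm is controlled by `log r < r - 1` at `r = (1 - u) / (1 - v)`; the
  -- increment of the inverse outweighs it since `1 - u ≤ 1`.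
  have h1 := Real.log_lt_sub_one_of_pos (div_pos hu1 hv1) (fun h => by
    rw [div_eq_one_iff_eq hv1.ne'] at h; linarith)
  rw [Real.log_div hu1.ne' hv1.ne'] at h1
  have h2 : (1 - v)⁻¹ - (1 - u)⁻¹ = (v - u) / ((1 - u) * (1 - v)) := by field_simp; ring
  have h3 : (1 - u) / (1 - v) - 1 = (v - u) / (1 - v) := by field_simp; ring
  have h4 : (v - u) / (1 - v) ≤ (v - u) / ((1 - u) * (1 - v)) := by
    apply div_le_div_of_nonneg_left (by linarith) (by positivity)
    nlinarith [hu.1]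
  simp only
  linarith

lemma sq_sqrt_sub_one_le {s : ℝ} (hs : 0 < s) : (√s - 1) ^ 2 ≤ s - 1 - Real.log s := by
  have h1 := Real.log_le_sub_one_of_pos (Real.sqrt_pos.2 hs)
  rw [Real.log_sqrt hs.le] at h1
  nlinarith [Real.sq_sqrt hs.le]

lemma sum_log_add_inv_lt (hn : 0 < n) (hd : ∀ i, 0 < d i) {s t : ℝ} (hs : 0 ≤ s) (hst : s < t)
    (ht : ∀ i, 0 < 1 - t * d i) :
    1 / 2 * ∑ i, (Real.log (1 - s * d i) + ((1 - s * d i)⁻¹ - 1)) <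
      1 / 2 * ∑ i, (Real.log (1 - t * d i) + ((1 - t * d i)⁻¹ - 1)) := by
  refine mul_lt_mul_of_pos_left (Finset.sum_lt_sum_of_nonempty ⟨⟨0, hn⟩, Finset.mem_univ _⟩
    fun i _ => ?_) (by norm_num)
  have h1 : s * d i < t * d i := mul_lt_mul_of_pos_right hst (hd i)
  exact strictMonoOn_log_add_inv ⟨mul_nonneg hs (hd i).le, by linarith [ht i]⟩
    ⟨(mul_nonneg hs (hd i).le).trans h1.le, by linarith [ht i]⟩ h1

lemma isRiskParam_unique (hn : 0 < n) {C : Matrix (Fin n) (Fin n) ℝ} (hC : C.PosDef) {c s t : ℝ}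
    (hs : IsRiskParam C c s) (ht : IsRiskParam C c t) : s = t := by
  obtain ⟨U, d, hU, hU', hd, rfl⟩ := exists_orthogonal_diagonalization hC
  obtain ⟨hs0, hs1, hs2⟩ := hs
  obtain ⟨ht0, ht1, ht2⟩ := ht
  rw [posDef_one_sub_iff hU] at hs1 ht1
  rw [gam_conj_diagonal hU hU' hs1] at hs2
  rw [gam_conj_diagonal hU hU' ht1] at ht2
  rcases lt_trichotomy s t with h | h | h
  · linarith [sum_log_add_inv_lt hn hd hs0 h ht1]
  · exact h
  · linarith [sum_log_add_inv_lt hn hd ht0 h hs1]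

lemma exists_isRiskParam (hn : 0 < n) {C : Matrix (Fin n) (Fin n) ℝ} (hC : C.PosDef) {c : ℝ}
    (hc : 0 ≤ c) : ∃ θ, IsRiskParam C c θ := by
  obtain ⟨U, d, hU, hU', hd, rfl⟩ := exists_orthogonal_diagonalization hC
  have : Nonempty (Fin n) := ⟨⟨0, hn⟩⟩
  obtain ⟨k, hk⟩ := Finite.exists_max d
  let φ (θ : ℝ) : ℝ := 1 / 2 * ∑ i, (Real.log (1 - θ * d i) + ((1 - θ * d i)⁻¹ - 1))
  -- Chosen so that `(√s - 1)² = 2c`. With `T` making `1 - T d_k = 1/s` at the largest eigenvalue,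
  -- the `k`-th summand alone is at least `2c`; the others are nonnegative, so `φ T ≥ c` without a
  -- limit at the boundary of the domain.
  let s : ℝ := (1 + √(2 * c)) ^ 2
  have hs : 1 ≤ s := by
    have := Real.sqrt_nonneg (2 * c)
    simp only [s]; nlinarith
  let T : ℝ := (1 - s⁻¹) / d k
  have hs1 : s⁻¹ ≤ 1 := inv_le_one_of_one_le₀ hs
  have hT : 0 ≤ T := div_nonneg (by linarith) (hd k).le
  have hTk : 1 - T * d k = s⁻¹ := by
    simp only [T]; have := (hd k).ne'; field_simp; ring
  have hpos (θ : ℝ) (hθ : θ ∈ Set.Icc 0 T) (i : Fin n) : 0 < 1 - θ * d i := by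
    have h1 : θ * d i ≤ T * d k := mul_le_mul hθ.2 (hk i) (hd i).le hT
    have h2 : 0 < s⁻¹ := by positivity
    linarith
  have hcont : ContinuousOn φ (Set.Icc 0 T) := by
    refine ContinuousOn.mul continuousOn_const (continuousOn_finsetSum _ fun i _ => ?_)
    have h1 : ContinuousOn (fun θ : ℝ => 1 - θ * d i) (Set.Icc 0 T) := by fun_prop
    exact (h1.log fun θ hθ => (hpos θ hθ i).ne').add
      ((h1.inv₀ fun θ hθ => (hpos θ hθ i).ne').sub continuousOn_const)
  have hφ0 : φ 0 = 0 := by simp [φ]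
  have hφT : c ≤ φ T := by
    have h1 : Real.log (1 - T * d k) + ((1 - T * d k)⁻¹ - 1) ≤
        ∑ i, (Real.log (1 - T * d i) + ((1 - T * d i)⁻¹ - 1)) := by
      refine Finset.single_le_sum (f := fun i => Real.log (1 - T * d i) + ((1 - T * d i)⁻¹ - 1))
        (fun i _ => ?_) (Finset.mem_univ k)
      have hp := hpos T ⟨hT, le_rfl⟩ i
      have := Real.log_le_sub_one_of_pos (inv_pos.2 hp)
      rw [Real.log_inv] at this
      linarith
    have h2 := sq_sqrt_sub_one_le (by linarith : 0 < s)
    rw [hTk, inv_inv, Real.log_inv] at h1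
    have h3 : √s = 1 + √(2 * c) := Real.sqrt_sq (by positivity)
    rw [h3, add_sub_cancel_left, Real.sq_sqrt (by positivity)] at h2
    simp only [φ]
    linarith
  obtain ⟨θ, hθ, hθc⟩ := intermediate_value_Icc hT hcont ⟨hφ0.le.trans hc, hφT⟩
  refine ⟨θ, hθ.1, (posDef_one_sub_iff hU θ).2 (hpos θ hθ), ?_⟩
  rw [gam_conj_diagonal hU hU' (hpos θ hθ)]
  exact hθc

lemma IsRiskParam.pos {C : Matrix (Fin n) (Fin n) ℝ} {c θ : ℝ} (h : IsRiskParam C c θ)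
    (hc : 0 < c) : 0 < θ := by
  refine lt_of_le_of_ne h.1 ?_
  rintro rfl
  have := h.2.2
  simp [gam] at this
  exact hc.ne this

end Spectral

/-! ### Densities of product measures -/

section Density

lemma lintegral_pi_prod {k : ℕ} {α : Fin k → Type} [∀ i, MeasurableSpace (α i)]
    (μ : ∀ i, Measure (α i)) [∀ i, SigmaFinite (μ i)] {f : ∀ i, α i → ℝ≥0∞}
    (hf : ∀ i, Measurable (f i)) :
    ∫⁻ x, ∏ i, f i (x i) ∂(Measure.pi μ) = ∏ i, ∫⁻ x, f i x ∂(μ i) := by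
  induction k with
  | zero => simp
  | succ k ih =>
    have h := (measurePreserving_piFinSuccAbove μ 0).symm
    rw [← h.lintegral_comp_emb (MeasurableEquiv.measurableEmbedding _), Fin.prod_univ_succ]
    have h2 := ih (fun i => μ i.succ) (fun i => hf i.succ)
    rw [← h2, ← lintegral_prod_mul (hf 0).aemeasurable
      (Finset.measurable_prod _ fun i _ => (hf i.succ).comp (measurable_pi_apply i)).aemeasurable]
    refine lintegral_congr fun z => ?_
    rw [Fin.prod_univ_succ]
    rfl

lemma pi_withDensity {k : ℕ} {α : Fin k → Type} [∀ i, MeasurableSpace (α i)]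
    (μ : ∀ i, Measure (α i)) [∀ i, SigmaFinite (μ i)] {f : ∀ i, α i → ℝ≥0∞}
    (hf : ∀ i, Measurable (f i)) [∀ i, SigmaFinite ((μ i).withDensity (f i))] :
    Measure.pi (fun i => (μ i).withDensity (f i)) =
      (Measure.pi μ).withDensity fun x => ∏ i, f i (x i) := by
  refine Measure.pi_eq fun s hs => ?_
  rw [withDensity_apply _ (MeasurableSet.univ_pi hs), Measure.restrict_pi_pi,
    lintegral_pi_prod _ hf]
  exact Finset.prod_congr rfl fun i _ => (withDensity_apply _ (hs i)).symm

lemma withDensity_map {α β : Type*} [MeasurableSpace α] [MeasurableSpace β] {μ : Measure α}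
    {g : α → β} (hg : Measurable g) {f : β → ℝ≥0∞} (hf : Measurable f) :
    (μ.map g).withDensity f = (μ.withDensity fun a => f (g a)).map g := by
  ext s hs
  rw [withDensity_apply _ hs, Measure.map_apply hg hs, withDensity_apply _ (hg hs),
    setLIntegral_map hs hf hg]

end Density

/-! ### Gaussian measures -/

section Gaussian

variable {n m : ℕ}

open scoped RealInnerProductSpace

lemma inner_mv_left (A : Matrix (Fin n) (Fin m) ℝ) (v : Vec m) (t : Vec n) :
    ⟪mv A v, t⟫ = ⟪v, mv A.transpose t⟫ := by
  simp only [mv, EuclideanSpace.inner_eq_star_dotProduct, star_trivial]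
  rw [dotProduct_comm, Matrix.mulVec_transpose, ← Matrix.dotProduct_mulVec, dotProduct_comm,
    dotProduct_comm]

lemma continuous_mv (A : Matrix (Fin n) (Fin m) ℝ) : Continuous (mv A) := by
  unfold mv
  fun_prop

@[fun_prop]
lemma measurable_mv (A : Matrix (Fin n) (Fin m) ℝ) : Measurable (mv A) :=
  (continuous_mv A).measurable

lemma mv_add (A : Matrix (Fin n) (Fin m) ℝ) (u v : Vec m) : mv A (u + v) = mv A u + mv A v := by
  simp [mv, Matrix.mulVec_add]

lemma mv_sub (A : Matrix (Fin n) (Fin m) ℝ) (u v : Vec m) : mv A (u - v) = mv A u - mv A v := by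
  simp [mv, Matrix.mulVec_sub]

lemma map_mv_multivariateGaussian {C : Matrix (Fin m) (Fin m) ℝ} (hC : C.PosSemidef) (μ : Vec m)
    (b : Vec n) (A : Matrix (Fin n) (Fin m) ℝ) :
    (multivariateGaussian μ C).map (fun v => b + mv A v) =
      multivariateGaussian (b + mv A μ) (A * C * A.transpose) := by
  have hm : Measurable fun v : Vec m => b + mv A v := by fun_prop
  have := Measure.isProbabilityMeasure_map (μ := multivariateGaussian μ C) hm.aemeasurable
  have hAC : (A * C * A.transpose).PosSemidef := by
    have := hC.mul_mul_conjTranspose_same A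
    rwa [Matrix.conjTranspose_eq_transpose_of_trivial] at this
  refine Measure.ext_of_charFun ?_
  ext t
  rw [charFun_multivariateGaussian hAC, charFun_apply, integral_map hm.aemeasurable (by fun_prop)]
  have h1 (v : Vec m) : Complex.exp (⟪b + mv A v, t⟫ * Complex.I) =
      Complex.exp (⟪b, t⟫ * Complex.I) * Complex.exp (⟪v, mv A.transpose t⟫ * Complex.I) := by
    rw [← Complex.exp_add, inner_add_left, inner_mv_left]
    push_cast
    ring_nf
  simp_rw [h1]
  rw [integral_const_mul, ← charFun_apply, charFun_multivariateGaussian hC, ← Complex.exp_add]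
  have h2 : (mv A.transpose t).ofLp ⬝ᵥ C.mulVec (mv A.transpose t).ofLp =
      t.ofLp ⬝ᵥ (A * C * A.transpose).mulVec t.ofLp := by
    simp only [mv]
    rw [← Matrix.mulVec_mulVec, ← Matrix.mulVec_mulVec, Matrix.dotProduct_mulVec t.ofLp A,
      Matrix.mulVec_transpose]
  have h3 : ⟪mv A.transpose t, μ⟫ = ⟪t, mv A μ⟫ := by
    rw [inner_mv_left, Matrix.transpose_transpose]
  rw [h2, h3, inner_add_right, real_inner_comm t b]
  push_cast
  ring_nf

lemma stdGaussian_map_mv (A : Matrix (Fin n) (Fin m) ℝ) :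
    (stdGaussian (Vec m)).map (mv A) = multivariateGaussian 0 (A * A.transpose) := by
  have := map_mv_multivariateGaussian (n := n) Matrix.PosSemidef.one (0 : Vec m) 0 A
  have h : mv A 0 = 0 := by simp [mv]
  simpa only [multivariateGaussian_zero_one, zero_add, Matrix.mul_one, h] using this

lemma map_pi_gaussianReal_mv (A : Matrix (Fin n) (Fin m) ℝ) :
    (Measure.pi fun _ : Fin m => gaussianReal 0 1).map (fun z => mv A (WithLp.toLp 2 z)) =
      multivariateGaussian 0 (A * A.transpose) := by
  rw [← stdGaussian_map_mv, ← map_pi_eq_stdGaussian, Measure.map_map (by fun_prop) (by fun_prop)]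
  rfl

lemma volume_absolutelyContinuous_stdGaussian : (volume : Measure (Vec n)) ≪ stdGaussian (Vec n) := by
  have h : (Measure.pi fun _ : Fin n => gaussianReal 0 1) =
      (volume : Measure (Fin n → ℝ)).withDensity fun x => ∏ i, gaussianPDF 0 1 (x i) := by
    have : SigmaFinite ((volume : Measure ℝ).withDensity (gaussianPDF 0 1)) := by
      rw [← gaussianReal_of_var_ne_zero 0 one_ne_zero]; infer_instance
    rw [volume_pi, ← pi_withDensity _ fun _ => measurable_gaussianPDF 0 1]
    simp_rw [gaussianReal_of_var_ne_zero 0 one_ne_zero]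
  have hac : (volume : Measure (Fin n → ℝ)) ≪ Measure.pi fun _ : Fin n => gaussianReal 0 1 := by
    rw [h]
    refine withDensity_absolutelyContinuous' (Measurable.aemeasurable ?_) (ae_of_all _ fun x => ?_)
    · exact Finset.measurable_prod _ fun i _ =>
        (measurable_gaussianPDF 0 1).comp (measurable_pi_apply i)
    · exact Finset.prod_ne_zero_iff.2 fun i _ => (gaussianPDF_pos 0 one_ne_zero _).ne'
  rw [← map_pi_eq_stdGaussian, ← (EuclideanSpace.volume_preserving_symm_measurableEquiv_toLp _).symm.map_eq]
  exact hac.map (by fun_prop)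

/-- A nondegenerate Gaussian law is the image of the standard one under an invertible affine map,
and such maps preserve the Lebesgue null sets. This converts uniqueness almost everywhere for the
law of `y` into uniqueness up to Lebesgue null sets. -/
lemma volume_absolutelyContinuous_multivariateGaussian {C : Matrix (Fin n) (Fin n) ℝ}
    (hC : C.PosDef) (μ : Vec n) : (volume : Measure (Vec n)) ≪ multivariateGaussian μ C := by
  open scoped MatrixOrder in
  let A := Matrix.toEuclideanCLM (𝕜 := ℝ) (CFC.sqrt C)
  have hA : IsUnit A := by
    refine IsUnit.map _ ?_
    have : CFC.sqrt C * CFC.sqrt C = C := CFC.sqrt_mul_sqrt_self C hC.posSemidef.nonneg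
    exact isUnit_of_mul_isUnit_left (this ▸ hC.isUnit)
  have hA' : IsUnit (A : Vec n →ₗ[ℝ] Vec n) := 
    hA.map (ContinuousLinearMap.toLinearMapRingHom : (Vec n →L[ℝ] Vec n) →+* _)
  have hdet : LinearMap.det (A : Vec n →ₗ[ℝ] Vec n) ≠ 0 := (LinearMap.isUnit_det _ hA').ne_zero
  have h1 := Measure.map_linearMap_addHaar_eq_smul_addHaar (volume : Measure (Vec n)) hdet
  have h2 : (volume : Measure (Vec n)) ≪ volume.map A := by
    change _ ≪ volume.map (A : Vec n →ₗ[ℝ] Vec n)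
    rw [h1]
    exact Measure.absolutelyContinuous_smul (by simpa using hdet)
  have h3 : (stdGaussian (Vec n)).map (fun z => μ + A z) = multivariateGaussian μ C := rfl
  rw [← h3]
  have h4 : (fun z => μ + A z) = (fun z => μ + z) ∘ A := rfl
  rw [h4, ← Measure.map_map (by fun_prop) (by fun_prop), ← (measurePreserving_add_left volume μ).map_eq]
  exact (h2.trans (volume_absolutelyContinuous_stdGaussian.map (by fun_prop))).map (by fun_prop)

/-- Tilting by `u x² / 2` rescales the standard normal to variance `(1 - u)⁻¹`. Stating the result
as an image measure lets it be tensorized over the eigendirections. -/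
lemma gaussianReal_withDensity_exp_sq {u : ℝ} (hu : 0 < 1 - u) :
    (gaussianReal 0 1).withDensity (fun x => ENNReal.ofReal (√(1 - u) * Real.exp (u / 2 * x ^ 2))) =
      (gaussianReal 0 1).map fun x => (√(1 - u))⁻¹ * x := by
  have hs : 0 < √(1 - u) := Real.sqrt_pos.2 hu
  have hv : NNReal.mk ((√(1 - u))⁻¹ ^ 2) (sq_nonneg _) * 1 ≠ 0 := by
    rw [mul_one, ne_eq, ← NNReal.coe_eq_zero]
    simp only [NNReal.coe_mk]
    positivity
  rw [gaussianReal_map_const_mul, mul_zero, gaussianReal_of_var_ne_zero 0 hv,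
    gaussianReal_of_var_ne_zero 0 one_ne_zero,
    ← withDensity_mul _ (measurable_gaussianPDF 0 1) (by fun_prop)]
  congr 1
  ext x
  simp only [Pi.mul_apply, gaussianPDF]
  rw [← ENNReal.ofReal_mul (gaussianPDFReal_nonneg _ _ _)]
  congr 1
  simp only [gaussianPDFReal, mul_one, NNReal.coe_mk, NNReal.coe_one, sub_zero, inv_pow,
    Real.sq_sqrt hu.le]
  rw [mul_assoc, mul_left_comm _ (√(1 - u)), ← Real.exp_add, ← mul_assoc]
  congr 1
  · rw [Real.sqrt_mul (by positivity) (1 - u)⁻¹, Real.sqrt_inv, mul_inv, inv_inv]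
  · congr 1
    field_simp
    ring

lemma norm_sq_mv_orthogonal {U : Matrix (Fin n) (Fin n) ℝ} (hU' : U.transpose * U = 1) (v : Vec n) :
    ‖mv U v‖ ^ 2 = ‖v‖ ^ 2 := by
  rw [← real_inner_self_eq_norm_sq, inner_mv_left, ← real_inner_self_eq_norm_sq]
  congr 1
  simp [mv, hU']

/-- Exponential tilting of a centered Gaussian law by `θ/2 ‖e‖²`. -/
lemma multivariateGaussian_withDensity_exp_sq {C : Matrix (Fin n) (Fin n) ℝ} (hC : C.PosDef)
    {θ : ℝ} (hθ : (1 - θ • C).PosDef) :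
    (multivariateGaussian 0 C).withDensity
        (fun e => ENNReal.ofReal (√(1 - θ • C).det * Real.exp (θ / 2 * ‖e‖ ^ 2))) =
      multivariateGaussian 0 (inflate C θ) := by
  obtain ⟨U, d, hU, hU', hd, rfl⟩ := exists_orthogonal_diagonalization hC
  rw [posDef_one_sub_iff hU] at hθ
  rw [inflate_conj_diagonal hU hU' hd hθ, det_one_sub hU]
  -- Both covariances are factored through the same eigenbasis, so both laws become linear images of
  -- product measures; in these coordinates the tilting density is a product of one-dimensional
  -- ones.
  have hdiag {a b : Fin n → ℝ} (h : ∀ i, b i * b i = a i) :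
      U * Matrix.diagonal a * U.transpose =
        (U * Matrix.diagonal b) * (U * Matrix.diagonal b).transpose := by
    have h' : Matrix.diagonal a = Matrix.diagonal b * Matrix.diagonal b := by
      rw [Matrix.diagonal_mul_diagonal]; congr 1; ext i; exact (h i).symm
    rw [Matrix.transpose_mul, Matrix.diagonal_transpose, h']
    simp only [mul_assoc]
  rw [hdiag (b := fun i => √(d i)) fun i => Real.mul_self_sqrt (hd i).le,
    hdiag (b := fun i => √(d i) * (√(1 - θ * d i))⁻¹) fun i => by
      rw [mul_mul_mul_comm, Real.mul_self_sqrt (hd i).le, ← mul_inv,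
        Real.mul_self_sqrt (hθ i).le],
    ← map_pi_gaussianReal_mv, ← map_pi_gaussianReal_mv,
    withDensity_map (by fun_prop) (by fun_prop)]
  have hnorm (z : Fin n → ℝ) :
      ‖mv (U * Matrix.diagonal fun i => √(d i)) (WithLp.toLp 2 z)‖ ^ 2 = ∑ i, d i * z i ^ 2 := by
    have : mv (U * Matrix.diagonal fun i => √(d i)) (WithLp.toLp 2 z) =
        mv U (WithLp.toLp 2 fun i => √(d i) * z i) := by
      simp only [mv, ← Matrix.mulVec_mulVec]
      congr 2
      ext i
      simp [Matrix.mulVec_diagonal]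
    rw [this, norm_sq_mv_orthogonal hU', EuclideanSpace.real_norm_sq_eq]
    exact Finset.sum_congr rfl fun i _ => by
      rw [mul_pow, Real.sq_sqrt (hd i).le]
  have hdens (z : Fin n → ℝ) : ENNReal.ofReal (√(∏ i, (1 - θ * d i)) * Real.exp (θ / 2 *
      ‖mv (U * Matrix.diagonal fun i => √(d i)) (WithLp.toLp 2 z)‖ ^ 2)) =
      ∏ i, ENNReal.ofReal (√(1 - θ * d i) * Real.exp (θ * d i / 2 * z i ^ 2)) := by
    rw [← ENNReal.ofReal_prod_of_nonneg fun i _ => by positivity, Finset.prod_mul_distrib,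
      ← Real.exp_sum, hnorm, Real.sqrt_prod _ fun i _ => (hθ i).le, Finset.mul_sum]
    congr 4
    ext i
    ring
  simp_rw [hdens]
  have hsf (i : Fin n) : SigmaFinite ((gaussianReal 0 1).withDensity
      fun x => ENNReal.ofReal (√(1 - θ * d i) * Real.exp (θ * d i / 2 * x ^ 2))) := by
    rw [gaussianReal_withDensity_exp_sq (hθ i)]
    have : IsProbabilityMeasure ((gaussianReal 0 1).map fun x => (√(1 - θ * d i))⁻¹ * x) :=
      Measure.isProbabilityMeasure_map (by fun_prop)
    infer_instance
  have hsf' (i : Fin n) : SigmaFinite ((gaussianReal 0 1).map fun x => (√(1 - θ * d i))⁻¹ * x) := by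
    rw [← gaussianReal_withDensity_exp_sq (hθ i)]; exact hsf i
  have hpi := pi_withDensity (fun _ : Fin n => gaussianReal 0 1)
    (f := fun i x => ENNReal.ofReal (√(1 - θ * d i) * Real.exp (θ * d i / 2 * x ^ 2)))
    (fun i => by fun_prop)
  rw [← hpi]
  simp_rw [fun i => gaussianReal_withDensity_exp_sq (hθ i)]
  rw [← Measure.pi_map_pi (fun i => by fun_prop), Measure.map_map (by fun_prop) (by fun_prop)]
  congr 1
  funext z
  simp only [Function.comp, mv, ← Matrix.mulVec_mulVec]
  congr 2
  ext j
  simp [Matrix.mulVec_diagonal, mul_assoc]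

/-- The tilted measure is a probability law, so the normalizing constant can be read off from its
total mass. -/
lemma integral_exp_norm_sq_multivariateGaussian {C : Matrix (Fin n) (Fin n) ℝ} (hC : C.PosDef)
    {θ : ℝ} (hθ : (1 - θ • C).PosDef) :
    Integrable (fun e => Real.exp (θ / 2 * ‖e‖ ^ 2)) (multivariateGaussian 0 C) ∧
      ∫ e, Real.exp (θ / 2 * ‖e‖ ^ 2) ∂(multivariateGaussian 0 C) = (√(1 - θ • C).det)⁻¹ := by
  have hs : 0 < √(1 - θ • C).det := Real.sqrt_pos.2 hθ.det_pos
  have h1 : ∫⁻ e, ENNReal.ofReal (√(1 - θ • C).det * Real.exp (θ / 2 * ‖e‖ ^ 2))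
      ∂(multivariateGaussian 0 C) = 1 := by
    have h := congrArg (fun μ : Measure (Vec n) => μ Set.univ)
      (multivariateGaussian_withDensity_exp_sq hC hθ)
    simpa [withDensity_apply] using h
  have hint : Integrable (fun e => √(1 - θ • C).det * Real.exp (θ / 2 * ‖e‖ ^ 2))
      (multivariateGaussian 0 C) := by
    refine ⟨by fun_prop, ?_⟩
    rw [hasFiniteIntegral_iff_ofReal (ae_of_all _ fun e => by positivity), h1]
    exact ENNReal.one_lt_top
  refine ⟨(integrable_const_mul_iff (IsUnit.mk0 _ hs.ne') _).1 hint, ?_⟩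
  have h2 := integral_eq_lintegral_of_nonneg_ae (μ := multivariateGaussian 0 C)
    (f := fun e => √(1 - θ • C).det * Real.exp (θ / 2 * ‖e‖ ^ 2))
    (ae_of_all _ fun e => by positivity) (by fun_prop)
  rw [h1, integral_const_mul, ENNReal.toReal_one] at h2
  exact eq_inv_of_mul_eq_one_right h2

/-- The exponential tilting of a centered Gaussian law by `θ/2 ‖e‖²` is Gaussian. -/
lemma multivariateGaussian_tilted {C : Matrix (Fin n) (Fin n) ℝ} (hC : C.PosDef) {θ : ℝ}
    (hθ : (1 - θ • C).PosDef) :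
    (multivariateGaussian 0 C).tilted (fun e => θ / 2 * ‖e‖ ^ 2) =
      multivariateGaussian 0 (inflate C θ) := by
  rw [Measure.tilted, (integral_exp_norm_sq_multivariateGaussian hC hθ).2,
    ← multivariateGaussian_withDensity_exp_sq hC hθ]
  congr 1
  ext e
  rw [div_inv_eq_mul, mul_comm]

end Gaussian

/-! ### The Gibbs variational principle -/

section Gibbs

open InformationTheory

variable {Ω : Type*} [MeasurableSpace Ω] {μ ν : Measure Ω} [IsProbabilityMeasure μ]
  [IsProbabilityMeasure ν]

/-- Young's inequality for the conjugate pair `ρ log ρ - ρ` and `exp`, weakened by the constant `1`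
contained in `klFun`. It comes from `1 + t ≤ exp t` at `t = s - log ρ`. -/
lemma mul_le_klFun_add_exp {ρ : ℝ} (hρ : 0 ≤ ρ) (s : ℝ) : ρ * s ≤ klFun ρ + Real.exp s := by
  rcases hρ.eq_or_lt with rfl | hρ
  · rw [zero_mul, klFun_zero]; positivity
  · have h1 := Real.add_one_le_exp (s - Real.log ρ)
    rw [Real.exp_sub, Real.exp_log hρ, le_div_iff₀ hρ] at h1
    rw [klFun]
    nlinarith

/-- A function with an exponential moment under `ν` is integrable under each law of finite
divergence from `ν`. -/
lemma integrable_of_integrable_exp_of_klDiv_ne_top (h : klDiv μ ν ≠ ∞) {f : Ω → ℝ}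
    (hf : Measurable f) (hf0 : ∀ ω, 0 ≤ f ω) (hexp : Integrable (fun ω => Real.exp (f ω)) ν) :
    Integrable f μ := by
  have hac := (klDiv_ne_top_iff.1 h).1
  refine ⟨hf.aestronglyMeasurable, ?_⟩
  rw [hasFiniteIntegral_iff_ofReal (ae_of_all _ hf0)]
  rw [klDiv_eq_lintegral_klFun_of_ac hac] at h
  have h2 : ∫⁻ ω, ENNReal.ofReal (Real.exp (f ω)) ∂ν < ∞ :=
    (hasFiniteIntegral_iff_ofReal (ae_of_all _ fun ω => (Real.exp_pos _).le)).1 hexp.2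
  have h3 : ∫⁻ ω, ENNReal.ofReal (f ω) ∂μ =
      ∫⁻ ω, μ.rnDeriv ν ω * ENNReal.ofReal (f ω) ∂ν :=
    (lintegral_rnDeriv_mul hac hf.ennreal_ofReal.aemeasurable).symm
  rw [h3]
  refine lt_of_le_of_lt (lintegral_mono_ae ?_)
    ((lintegral_add_left (by fun_prop) _).trans_lt (ENNReal.add_lt_top.2 ⟨h.lt_top, h2⟩))
  filter_upwards [Measure.rnDeriv_lt_top μ ν] with ω hω
  rw [← ENNReal.ofReal_toReal hω.ne, ← ENNReal.ofReal_mul ENNReal.toReal_nonneg,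
    ← ENNReal.ofReal_add (klFun_nonneg ENNReal.toReal_nonneg) (Real.exp_pos _).le,
    ENNReal.toReal_ofReal ENNReal.toReal_nonneg]
  exact ENNReal.ofReal_le_ofReal (mul_le_klFun_add_exp ENNReal.toReal_nonneg _)

variable {F : Ω → ℝ}

/-- The Gibbs identity: the log-density against the tilted law differs from that against `ν` by `F`
minus the log-partition function. -/
lemma klDiv_tilted_right (h : klDiv μ ν ≠ ∞) (hF : Integrable F μ)
    (hexp : Integrable (fun ω => Real.exp (F ω)) ν) :
    klDiv μ (ν.tilted F) ≠ ∞ ∧ (klDiv μ (ν.tilted F)).toReal =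
      (klDiv μ ν).toReal - ∫ ω, F ω ∂μ + Real.log (∫ ω, Real.exp (F ω) ∂ν) := by
  obtain ⟨hac, hint⟩ := klDiv_ne_top_iff.1 h
  have := isProbabilityMeasure_tilted hexp
  have hac' : μ ≪ ν.tilted F := hac.trans (absolutelyContinuous_tilted hexp)
  refine ⟨klDiv_ne_top hac' (integrable_llr_tilted_right hac hF hint hexp), ?_⟩
  rw [toReal_klDiv_of_measure_eq hac' (by simp), toReal_klDiv_of_measure_eq hac (by simp),
    integral_llr_tilted_right hac hF hexp hint]

lemma klDiv_tilted_left (hF : Integrable F (ν.tilted F))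
    (hexp : Integrable (fun ω => Real.exp (F ω)) ν) :
    klDiv (ν.tilted F) ν =
      ENNReal.ofReal (∫ ω, F ω ∂(ν.tilted F) - Real.log (∫ ω, Real.exp (F ω) ∂ν)) := by
  have := isProbabilityMeasure_tilted hexp
  have hac := tilted_absolutelyContinuous ν F
  have hllr : llr (ν.tilted F) ν =ᵐ[ν.tilted F]
      fun ω => F ω - Real.log (∫ ω, Real.exp (F ω) ∂ν) :=
    hac.ae_le (log_rnDeriv_tilted_left_self hexp)
  have hint : Integrable (llr (ν.tilted F) ν) (ν.tilted F) := by
    rw [integrable_congr hllr]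
    exact hF.sub (integrable_const _)
  rw [← ENNReal.ofReal_toReal (klDiv_ne_top hac hint), toReal_klDiv_of_measure_eq hac (by simp),
    integral_congr_ae hllr, integral_sub hF (integrable_const _)]
  simp

end Gibbs

/-! ### Laws with an error independent of the observation -/

section ErrorLaw

variable {n m : ℕ}

open scoped RealInnerProductSpace

lemma continuous_stateOf : Continuous (stateOf : Joint n m → Vec n) := by
  unfold stateOf; fun_prop

lemma continuous_obsOf : Continuous (obsOf : Joint n m → Vec m) := by
  unfold obsOf; fun_prop

@[fun_prop]
lemma measurable_stateOf : Measurable (stateOf : Joint n m → Vec n) := continuous_stateOf.measurable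

@[fun_prop]
lemma measurable_obsOf : Measurable (obsOf : Joint n m → Vec m) := continuous_obsOf.measurable

lemma measurable_stack : Measurable fun z : Vec n × Vec m => stack z.1 z.2 := by
  have : Continuous fun z : Vec n × Vec m => stack z.1 z.2 := by
    unfold stack
    refine (PiLp.continuous_toLp 2 _).comp (continuous_pi fun i => ?_)
    rcases i with i | i
    · simp only [Sum.elim_inl]; fun_prop
    · simp only [Sum.elim_inr]; fun_prop
  exact this.measurable

@[simp]
lemma stateOf_stack (a : Vec n) (b : Vec m) : stateOf (stack a b) = a := rfl

@[simp]
lemma obsOf_stack (a : Vec n) (b : Vec m) : obsOf (stack a b) = b := rfl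

lemma inner_stack_left (a : Vec n) (b : Vec m) (t : Joint n m) :
    ⟪stack a b, t⟫ = ⟪a, stateOf t⟫ + ⟪b, obsOf t⟫ := by
  simp [stack, stateOf, obsOf, PiLp.inner_apply]

/-- The law of `[g(y) + e; y]` when `e` and `y` are independent with the laws `ν` and `κ`. -/
def errorLaw (g : Vec m → Vec n) (ν : Measure (Vec n)) (κ : Measure (Vec m)) :
    Measure (Joint n m) :=
  (ν.prod κ).map fun z => stack (g z.2 + z.1) z.2

variable {g : Vec m → Vec n} {ν : Measure (Vec n)} {κ : Measure (Vec m)}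

lemma measurable_stack_add (hg : Measurable g) :
    Measurable fun z : Vec n × Vec m => stack (g z.2 + z.1) z.2 :=
  measurable_stack.comp (by fun_prop : Measurable fun z : Vec n × Vec m => (g z.2 + z.1, z.2))

instance [IsFiniteMeasure ν] [IsFiniteMeasure κ] : IsFiniteMeasure (errorLaw g ν κ) := by
  unfold errorLaw; infer_instance

lemma errorLaw_map_error [SFinite ν] [IsProbabilityMeasure κ] (hg : Measurable g) :
    (errorLaw g ν κ).map (fun w => stateOf w - g (obsOf w)) = ν := by
  rw [errorLaw, Measure.map_map (by fun_prop) (measurable_stack_add hg)]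
  have : (fun w : Joint n m => stateOf w - g (obsOf w)) ∘
      (fun z : Vec n × Vec m => stack (g z.2 + z.1) z.2) = Prod.fst := by
    ext1 z; simp
  rw [this]
  exact Measure.fst_prod

variable [IsProbabilityMeasure ν] [IsProbabilityMeasure κ]

lemma isProbabilityMeasure_errorLaw (hg : Measurable g) : IsProbabilityMeasure (errorLaw g ν κ) :=
  Measure.isProbabilityMeasure_map (measurable_stack_add hg).aemeasurable

lemma errorLaw_map_obsOf (hg : Measurable g) : (errorLaw g ν κ).map obsOf = κ := by
  rw [errorLaw, Measure.map_map (by fun_prop) (measurable_stack_add hg)]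
  exact Measure.snd_prod

/-- The tilting function depends on `e` alone, so in the coordinates `(e, y)` the density acts on
the first factor of the product measure. -/
lemma errorLaw_tilted (hg : Measurable g) {F : Vec n → ℝ} (hF : Measurable F) :
    (errorLaw g ν κ).tilted (fun w => F (stateOf w - g (obsOf w))) =
      errorLaw g (ν.tilted F) κ := by
  have h1 : ∫ w, Real.exp (F (stateOf w - g (obsOf w))) ∂(errorLaw g ν κ) =
      ∫ e, Real.exp (F e) ∂ν := by
    rw [← errorLaw_map_error (ν := ν) (κ := κ) hg, integral_map (by fun_prop) (by fun_prop),
      errorLaw_map_error hg]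
  rw [Measure.tilted, h1, errorLaw, withDensity_map (measurable_stack_add hg) (by fun_prop),
    errorLaw, Measure.tilted, prod_withDensity_left (by fun_prop)]
  simp

lemma condDistrib_errorLaw (hg : Measurable g) :
    ∀ᵐ y ∂((errorLaw g ν κ).map obsOf), condDistrib stateOf obsOf (errorLaw g ν κ) y =
      ν.map fun e => g y + e := by
  have hm : Measurable fun z : Vec m × Vec n => g z.1 + z.2 := by fun_prop
  let η : Kernel (Vec m) (Vec n) := (Kernel.id ×ₖ Kernel.const (Vec m) ν).map fun z => g z.1 + z.2
  have hη (y : Vec m) : η y = ν.map fun e => g y + e := by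
    rw [Kernel.map_apply _ hm, Kernel.prod_apply, Kernel.id_apply, Kernel.const_apply,
      Measure.dirac_prod, Measure.map_map hm (by fun_prop)]
    rfl
  have : IsMarkovKernel η := Kernel.IsMarkovKernel.map _ hm
  have h : (errorLaw g ν κ).map (fun w => (obsOf w, stateOf w)) =
      (errorLaw g ν κ).map obsOf ⊗ₘ η := by
    rw [errorLaw_map_obsOf hg]
    ext s hs
    rw [Measure.compProd_apply hs, errorLaw, Measure.map_map (by fun_prop) (measurable_stack_add hg),
      Measure.map_apply (Measurable.comp (by fun_prop) (measurable_stack_add hg)) hs,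
      Measure.prod_apply_symm ((Measurable.comp (by fun_prop) (measurable_stack_add hg)) hs)]
    refine lintegral_congr fun y => ?_
    rw [hη, Measure.map_apply (by fun_prop) (measurable_prodMk_left hs)]
    rfl
  filter_upwards [condDistrib_ae_eq_of_measure_eq_compProd_of_measurable (by fun_prop)
    (by fun_prop) h] with y hy
  rw [hy, hη]

/-- For an error independent of the observation, with mean zero, the mean square error splits. -/
lemma integral_norm_sq_errorLaw (hg : Measurable g) (hν : MemLp id 2 ν) (hν0 : ∫ e, e ∂ν = 0)
    {g' : Vec m → Vec n} (hg' : Measurable g') (hd : MemLp (fun y => g y - g' y) 2 κ) :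
    Integrable (fun w => ‖stateOf w - g' (obsOf w)‖ ^ 2) (errorLaw g ν κ) ∧
      ∫ w, ‖stateOf w - g' (obsOf w)‖ ^ 2 ∂(errorLaw g ν κ) =
        ∫ e, ‖e‖ ^ 2 ∂ν + ∫ y, ‖g y - g' y‖ ^ 2 ∂κ := by
  have hms := measurable_stack_add hg
  have hmeas : AEStronglyMeasurable (fun w : Joint n m => ‖stateOf w - g' (obsOf w)‖ ^ 2)
      ((ν.prod κ).map fun z => stack (g z.2 + z.1) z.2) :=
    Measurable.aestronglyMeasurable (by fun_prop)
  have h1 : Integrable (fun z : Vec n × Vec m => ‖z.1‖ ^ 2) (ν.prod κ) :=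
    (hν.integrable_norm_pow two_ne_zero).comp_fst κ
  have h2 : Integrable (fun z : Vec n × Vec m => ‖g z.2 - g' z.2‖ ^ 2) (ν.prod κ) :=
    (hd.integrable_norm_pow two_ne_zero).comp_snd ν
  have hν1 : Integrable (fun e : Vec n => e) ν := hν.integrable one_le_two
  have hd1 : Integrable (fun y => g y - g' y) κ := hd.integrable one_le_two
  have h3 : Integrable (fun z : Vec n × Vec m => ⟪z.1, g z.2 - g' z.2⟫) (ν.prod κ) := by
    refine (hν1.norm.mul_prod hd1.norm).mono' (Measurable.aestronglyMeasurable (by fun_prop))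
      (ae_of_all _ fun z => ?_)
    exact norm_inner_le_norm _ _
  -- The cross term vanishes because `e` has mean zero and is independent of `y`.
  have h4 : ∫ z : Vec n × Vec m, ⟪z.1, g z.2 - g' z.2⟫ ∂(ν.prod κ) = 0 := by
    have h (v : Vec n) : ∫ e, ⟪e, v⟫ ∂ν = 0 := by
      simp_rw [real_inner_comm v]
      rw [integral_inner hν1, hν0, inner_zero_right]
    rw [integral_prod_symm _ h3]
    exact integral_eq_zero_of_ae (ae_of_all _ fun y => h (g y - g' y))
  have h5 (z : Vec n × Vec m) : ‖stateOf (stack (g z.2 + z.1) z.2) -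
      g' (obsOf (stack (g z.2 + z.1) z.2))‖ ^ 2 =
      ‖z.1‖ ^ 2 + 2 * ⟪z.1, g z.2 - g' z.2⟫ + ‖g z.2 - g' z.2‖ ^ 2 := by
    rw [← norm_add_sq_real]
    simp only [stateOf_stack, obsOf_stack]
    congr 2
    abel
  have h6 : Integrable (fun z : Vec n × Vec m => ‖z.1‖ ^ 2 + 2 * ⟪z.1, g z.2 - g' z.2⟫)
      (ν.prod κ) := h1.add (h3.const_mul 2)
  constructor
  · rw [errorLaw, integrable_map_measure hmeas hms.aemeasurable]
    simp only [Function.comp_def, h5]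
    exact h6.add h2
  · rw [errorLaw, integral_map hms.aemeasurable hmeas]
    simp_rw [h5]
    rw [integral_add h6 h2, integral_add h1 (h3.const_mul 2),
      integral_const_mul, h4, integral_fun_fst (fun e : Vec n => ‖e‖ ^ 2),
      integral_fun_snd (fun y => ‖g y - g' y‖ ^ 2)]
    simp

end ErrorLaw

/-! ### The minimax problem for a Gaussian error -/

section GaussianError

variable {n m : ℕ}

open scoped RealInnerProductSpace
open InformationTheory

/-- The regression decomposition `x + L (y - μ) + e` of a Gaussian pair, checked on characteristic
functions: independence factors the integral, and the exponents add up to the block quadratic form.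
-/
lemma errorLaw_multivariateGaussian {C : Matrix (Fin n) (Fin n) ℝ} (hC : C.PosDef)
    {K : Matrix (Fin m) (Fin m) ℝ} (hK : K.PosDef) (x : Vec n) (μ : Vec m)
    (L : Matrix (Fin n) (Fin m) ℝ) :
    errorLaw (fun y => x + mv L (y - μ)) (multivariateGaussian 0 C) (multivariateGaussian μ K) =
      multivariateGaussian (stack x μ)
        (Matrix.fromBlocks (C + L * K * L.transpose) (L * K) (L * K).transpose K) := by
  have hKt : K.transpose = K := by
    rw [← Matrix.conjTranspose_eq_transpose_of_trivial]; exact hK.1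
  have hpos : (Matrix.fromBlocks (C + L * K * L.transpose) (L * K) (L * K).transpose K).PosDef := by
    rw [posDef_fromBlocks_iff hK, Matrix.mul_nonsing_inv_cancel_right _ _ hK.det_pos.ne'.isUnit,
      Matrix.transpose_mul, hKt, Matrix.mul_assoc, add_sub_cancel_right]
    exact hC
  have hg : Measurable fun y : Vec m => x + mv L (y - μ) := by fun_prop
  have hms := measurable_stack_add hg
  have := isProbabilityMeasure_errorLaw (ν := multivariateGaussian 0 C)
    (κ := multivariateGaussian μ K) hg
  refine Measure.ext_of_charFun ?_
  ext t
  rw [charFun_multivariateGaussian hpos.posSemidef, charFun_apply, errorLaw,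
    integral_map hms.aemeasurable (by fun_prop)]
  have h1 (z : Vec n × Vec m) :
      Complex.exp (⟪stack (x + mv L (z.2 - μ) + z.1) z.2, t⟫ * Complex.I) =
      Complex.exp (⟪x - mv L μ, stateOf t⟫ * Complex.I) *
        (Complex.exp (⟪z.1, stateOf t⟫ * Complex.I) *
          Complex.exp (⟪z.2, mv L.transpose (stateOf t) + obsOf t⟫ * Complex.I)) := by
    rw [← Complex.exp_add, ← Complex.exp_add, inner_stack_left, mv_sub, inner_add_left,
      inner_add_left, inner_sub_left, inner_sub_left, inner_add_right z.2, ← inner_mv_left]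
    push_cast
    ring_nf
  simp_rw [h1]
  rw [integral_const_mul, integral_prod_mul
      (fun e : Vec n => Complex.exp (⟪e, stateOf t⟫ * Complex.I))
      (fun y : Vec m => Complex.exp (⟪y, mv L.transpose (stateOf t) + obsOf t⟫ * Complex.I)),
    ← charFun_apply, ← charFun_apply, charFun_multivariateGaussian hC.posSemidef,
    charFun_multivariateGaussian hK.posSemidef, ← Complex.exp_add, ← Complex.exp_add]
  have h2 : ⟪t, stack x μ⟫ = ⟪x - mv L μ, stateOf t⟫ +
      ⟪mv L.transpose (stateOf t) + obsOf t, μ⟫ := by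
    rw [real_inner_comm, inner_stack_left, inner_sub_left, inner_mv_left, inner_add_left,
      real_inner_comm μ, real_inner_comm μ]
    ring
  have h3 : t.ofLp ⬝ᵥ (Matrix.fromBlocks (C + L * K * L.transpose) (L * K)
      (L * K).transpose K).mulVec t.ofLp = (stateOf t).ofLp ⬝ᵥ C.mulVec (stateOf t).ofLp +
        (mv L.transpose (stateOf t) + obsOf t).ofLp ⬝ᵥ
          K.mulVec (mv L.transpose (stateOf t) + obsOf t).ofLp := by
    have ht : t.ofLp = Sum.elim (stateOf t).ofLp (obsOf t).ofLp := by
      ext i; rcases i with i | i <;> rfl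
    have h4 (a b : Fin n → ℝ) : a ⬝ᵥ L.mulVec (K.mulVec (L.transpose.mulVec b)) =
        L.transpose.mulVec a ⬝ᵥ K.mulVec (L.transpose.mulVec b) := by
      rw [Matrix.dotProduct_mulVec a L, ← Matrix.mulVec_transpose L a]
    rw [ht, dotProduct_fromBlocks_mulVec, Matrix.transpose_mul, hKt]
    simp only [mv, WithLp.ofLp_add, Matrix.add_mulVec, Matrix.mulVec_add, dotProduct_add,
      add_dotProduct, ← Matrix.mulVec_mulVec]
    rw [Matrix.dotProduct_mulVec (stateOf t).ofLp L, Matrix.dotProduct_mulVec (stateOf t).ofLp L,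
      ← Matrix.mulVec_transpose L]
    ring
  rw [h2, h3, inner_zero_right]
  push_cast
  ring_nf

lemma memLp_two_multivariateGaussian (C : Matrix (Fin n) (Fin n) ℝ) (μ : Vec n) :
    MemLp id 2 (multivariateGaussian μ C) := IsGaussian.memLp_two_id

lemma integral_norm_sq_multivariateGaussian {C : Matrix (Fin n) (Fin n) ℝ} (hC : C.PosSemidef) :
    ∫ e, ‖e‖ ^ 2 ∂(multivariateGaussian (0 : Vec n) C) = C.trace := by
  have hmem (i : Fin n) : MemLp (fun e : Vec n => e i) 2 (multivariateGaussian 0 C) :=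
    (memLp_two_multivariateGaussian C 0).of_le (by fun_prop)
      (ae_of_all _ fun e => PiLp.norm_apply_le e i)
  have hmean (i : Fin n) : ∫ e : Vec n, e i ∂(multivariateGaussian 0 C) = 0 := by
    have h := ContinuousLinearMap.integral_comp_comm (EuclideanSpace.proj (𝕜 := ℝ) i)
      ((memLp_two_multivariateGaussian C (0 : Vec n)).integrable one_le_two)
    simpa using h
  simp_rw [EuclideanSpace.real_norm_sq_eq]
  rw [integral_finsetSum _ fun i _ => (hmem i).integrable_sq, Matrix.trace]
  refine Finset.sum_congr rfl fun i _ => ?_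
  rw [Matrix.diag_apply, ← variance_eval_multivariateGaussian (μ := (0 : Vec n)) hC i,
    variance_of_integral_eq_zero (by fun_prop) (hmean i)]

lemma cost_eq_ofReal {p : Measure (Joint n m)} {g : Vec m → Vec n}
    (h : Integrable (fun w => ‖stateOf w - g (obsOf w)‖ ^ 2) p) :
    cost p g = ENNReal.ofReal (1 / 2 * ∫ w, ‖stateOf w - g (obsOf w)‖ ^ 2 ∂p) := by
  rw [cost, ENNReal.ofReal_mul (by norm_num),
    ofReal_integral_eq_lintegral_ofReal h (ae_of_all _ fun w => by positivity)]
  congr 1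
  · rw [ENNReal.ofReal_div_of_pos two_pos]; simp
  · exact lintegral_congr fun w => by rw [ENNReal.ofReal_pow (norm_nonneg _), ofReal_norm]

variable {g : Vec m → Vec n} {κ : Measure (Vec m)} [IsProbabilityMeasure κ]
  {C : Matrix (Fin n) (Fin n) ℝ}

lemma hasErrorCov_errorLaw (hg : Measurable g) (hC : C.PosSemidef) :
    HasErrorCov (errorLaw g (multivariateGaussian 0 C) κ) g C := by
  have hm : Measurable fun w : Joint n m => stateOf w - g (obsOf w) := by fun_prop
  have hmap := errorLaw_map_error (ν := multivariateGaussian 0 C) (κ := κ) hg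
  constructor
  · have h := memLp_two_multivariateGaussian C (0 : Vec n)
    rw [← hmap, memLp_map_measure_iff (by fun_prop) hm.aemeasurable] at h
    exact h
  · intro i j
    have h := covariance_eval_multivariateGaussian (μ := (0 : Vec n)) hC i j
    rw [← hmap, covariance_map (by fun_prop) (by fun_prop) hm.aemeasurable] at h
    exact h

variable {c θ : ℝ}

lemma errorLaw_tilted_gaussian (hg : Measurable g) (hC : C.PosDef) (hθ : (1 - θ • C).PosDef) :
    (errorLaw g (multivariateGaussian 0 C) κ).tilted
        (fun w => θ / 2 * ‖stateOf w - g (obsOf w)‖ ^ 2) =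
      errorLaw g (multivariateGaussian 0 (inflate C θ)) κ := by
  rw [← multivariateGaussian_tilted hC hθ]
  exact errorLaw_tilted hg (F := fun e => θ / 2 * ‖e‖ ^ 2) (by fun_prop)

lemma integral_exp_norm_sq_errorLaw (hg : Measurable g) (hC : C.PosDef)
    (hθ : (1 - θ • C).PosDef) :
    Integrable (fun w => Real.exp (θ / 2 * ‖stateOf w - g (obsOf w)‖ ^ 2))
        (errorLaw g (multivariateGaussian 0 C) κ) ∧
      Real.log (∫ w, Real.exp (θ / 2 * ‖stateOf w - g (obsOf w)‖ ^ 2)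
        ∂(errorLaw g (multivariateGaussian 0 C) κ)) = -(1 / 2 * Real.log (1 - θ • C).det) := by
  have hm : Measurable fun w : Joint n m => stateOf w - g (obsOf w) := by fun_prop
  have hmap := errorLaw_map_error (ν := multivariateGaussian 0 C) (κ := κ) hg
  obtain ⟨h1, h2⟩ := integral_exp_norm_sq_multivariateGaussian hC hθ
  rw [← hmap] at h1 h2
  rw [integrable_map_measure (by fun_prop) hm.aemeasurable] at h1
  rw [integral_map hm.aemeasurable (by fun_prop)] at h2
  refine ⟨h1, ?_⟩
  rw [h2, Real.log_inv, Real.log_sqrt hθ.det_pos.le]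
  ring

lemma integral_norm_sq_errorLaw_self (hg : Measurable g) (hC : C.PosSemidef) :
    Integrable (fun w => ‖stateOf w - g (obsOf w)‖ ^ 2)
        (errorLaw g (multivariateGaussian 0 C) κ) ∧
      ∫ w, ‖stateOf w - g (obsOf w)‖ ^ 2 ∂(errorLaw g (multivariateGaussian 0 C) κ) =
        C.trace := by
  have h := integral_norm_sq_errorLaw (κ := κ) hg (memLp_two_multivariateGaussian C 0)
    integral_id_multivariateGaussian hg (by simp)
  rw [integral_norm_sq_multivariateGaussian hC] at h
  simpa using h

lemma klDiv_errorLaw (hg : Measurable g) (hC : C.PosDef) (hθ : (1 - θ • C).PosDef) :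
    klDiv (errorLaw g (multivariateGaussian 0 (inflate C θ)) κ)
      (errorLaw g (multivariateGaussian 0 C) κ) = ENNReal.ofReal (gam C θ) := by
  have := isProbabilityMeasure_errorLaw (ν := multivariateGaussian 0 C) (κ := κ) hg
  obtain ⟨h1, h2⟩ := integral_exp_norm_sq_errorLaw (κ := κ) hg hC hθ
  obtain ⟨h3, h4⟩ := integral_norm_sq_errorLaw_self (κ := κ) hg (inflate_posDef hC hθ).posSemidef
  rw [← errorLaw_tilted_gaussian hg hC hθ] at h3 h4 ⊢
  rw [klDiv_tilted_left (h3.const_mul _) h1, h2, integral_const_mul, h4,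
    gam_eq_trace_inflate hC hθ, sub_neg_eq_add]

lemma errorLaw_mem_ball (hg : Measurable g) (hC : C.PosDef) (hθ : IsRiskParam C c θ) :
    errorLaw g (multivariateGaussian 0 (inflate C θ)) κ ∈
      ball (errorLaw g (multivariateGaussian 0 C) κ) c :=
  ⟨isProbabilityMeasure_errorLaw hg, by rw [klDiv_errorLaw hg hC hθ.2.1, hθ.2.2]⟩

/-- The mean square error is finite for all laws of the ambiguity set. -/
lemma integrable_norm_sq_error_of_mem_ball (hg : Measurable g) {p : Measure (Joint n m)}
    (hp : p ∈ ball (errorLaw g (multivariateGaussian 0 C) κ) c) :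
    Integrable (fun w => ‖stateOf w - g (obsOf w)‖ ^ 2) p := by
  have := hp.1
  have := isProbabilityMeasure_errorLaw (ν := multivariateGaussian 0 C) (κ := κ) hg
  have hm : Measurable fun w : Joint n m => stateOf w - g (obsOf w) := by fun_prop
  have hmap := errorLaw_map_error (ν := multivariateGaussian 0 C) (κ := κ) hg
  -- Fernique's theorem supplies a small exponential moment of `‖e‖²`, which the entropy inequality
  -- turns into integrability under every law of the ball.
  obtain ⟨ε, hε, hint⟩ := IsGaussian.exists_integrable_exp_sq (multivariateGaussian (0 : Vec n) C)
  rw [← hmap, integrable_map_measure (by fun_prop) hm.aemeasurable] at hint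
  have h := integrable_of_integrable_exp_of_klDiv_ne_top
    (ne_top_of_le_ne_top ENNReal.ofReal_ne_top hp.2)
    (f := fun w => ε * ‖stateOf w - g (obsOf w)‖ ^ 2) (by fun_prop) (fun w => by positivity) hint
  exact (integrable_const_mul_iff (IsUnit.mk0 _ hε.ne') _).1 h

/-- In the Gibbs identity, the bound `KL(p, p̄) ≤ c` is combined with `c = γ(C, θ)` written through
the trace; the log-determinant of the partition function cancels. -/
lemma klDiv_add_le_of_mem_ball (hc : 0 ≤ c) (hg : Measurable g) (hC : C.PosDef)
    (hθ : IsRiskParam C c θ) {p : Measure (Joint n m)}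
    (hp : p ∈ ball (errorLaw g (multivariateGaussian 0 C) κ) c) :
    klDiv p (errorLaw g (multivariateGaussian 0 (inflate C θ)) κ) ≠ ∞ ∧
      (klDiv p (errorLaw g (multivariateGaussian 0 (inflate C θ)) κ)).toReal +
        θ / 2 * ∫ w, ‖stateOf w - g (obsOf w)‖ ^ 2 ∂p ≤ θ / 2 * (inflate C θ).trace := by
  have := hp.1
  have := isProbabilityMeasure_errorLaw (ν := multivariateGaussian 0 C) (κ := κ) hg
  obtain ⟨h1, h2⟩ := integral_exp_norm_sq_errorLaw (κ := κ) hg hC hθ.2.1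
  have hint := integrable_norm_sq_error_of_mem_ball hg hp
  obtain ⟨h3, h4⟩ := klDiv_tilted_right (ne_top_of_le_ne_top ENNReal.ofReal_ne_top hp.2)
    (hint.const_mul (θ / 2)) h1
  rw [errorLaw_tilted_gaussian hg hC hθ.2.1] at h3 h4
  refine ⟨h3, ?_⟩
  have h5 := ENNReal.toReal_mono ENNReal.ofReal_ne_top hp.2
  rw [ENNReal.toReal_ofReal hc] at h5
  have h6 := gam_eq_trace_inflate hC hθ.2.1
  rw [hθ.2.2] at h6
  rw [h4, h2, integral_const_mul]
  linarith

lemma integral_norm_sq_error_le_trace (hc : 0 ≤ c) (hg : Measurable g) (hC : C.PosDef)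
    (hθ : IsRiskParam C c θ) {p : Measure (Joint n m)}
    (hp : p ∈ ball (errorLaw g (multivariateGaussian 0 C) κ) c) :
    ∫ w, ‖stateOf w - g (obsOf w)‖ ^ 2 ∂p ≤ (inflate C θ).trace ∧
      ((inflate C θ).trace ≤ ∫ w, ‖stateOf w - g (obsOf w)‖ ^ 2 ∂p →
        p = errorLaw g (multivariateGaussian 0 (inflate C θ)) κ) := by
  have := hp.1
  obtain ⟨h1, h2⟩ := klDiv_add_le_of_mem_ball hc hg hC hθ hp
  have hnn := ENNReal.toReal_nonneg
    (a := klDiv p (errorLaw g (multivariateGaussian 0 (inflate C θ)) κ))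
  have heq (h : (klDiv p (errorLaw g (multivariateGaussian 0 (inflate C θ)) κ)).toReal ≤ 0) :
      p = errorLaw g (multivariateGaussian 0 (inflate C θ)) κ :=
    klDiv_eq_zero_iff.1 (((ENNReal.toReal_eq_zero_iff _).1 (le_antisymm h hnn)).resolve_right h1)
  rcases hθ.1.eq_or_lt with h0 | h0
  -- For `θ = 0` the inequality cannot be divided by `θ`, but it then reads `KL ≤ 0`, so `p` is
  -- already the tilted law.
  · have hpe := heq (by rw [← h0] at h2 ⊢; linarith)
    refine ⟨?_, fun _ => hpe⟩
    rw [hpe, (integral_norm_sq_errorLaw_self hg (inflate_posDef hC hθ.2.1).posSemidef).2]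
  · constructor
    · by_contra! h
      have := mul_lt_mul_of_pos_left h (half_pos h0)
      linarith
    · intro h
      refine heq ?_
      have := mul_le_mul_of_nonneg_left h (half_pos h0).le
      linarith

/-- The tilted law is the only least favorable law. -/
lemma isLeastFavorable_errorLaw (hc : 0 ≤ c) (hg : Measurable g) (hC : C.PosDef)
    (hθ : IsRiskParam C c θ) :
    IsLeastFavorable (errorLaw g (multivariateGaussian 0 C) κ) c g
        (errorLaw g (multivariateGaussian 0 (inflate C θ)) κ) ∧
      ∀ p, IsLeastFavorable (errorLaw g (multivariateGaussian 0 C) κ) c g p →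
        p = errorLaw g (multivariateGaussian 0 (inflate C θ)) κ := by
  obtain ⟨h1, h2⟩ :=
    integral_norm_sq_errorLaw_self (κ := κ) hg (inflate_posDef hC hθ.2.1).posSemidef
  have hmem := errorLaw_mem_ball (κ := κ) hg hC hθ
  refine ⟨⟨hmem, fun p hp => ?_⟩, fun p hp => ?_⟩
  · rw [cost_eq_ofReal h1, cost_eq_ofReal (integrable_norm_sq_error_of_mem_ball hg hp), h2]
    refine ENNReal.ofReal_le_ofReal (mul_le_mul_of_nonneg_left ?_ (by norm_num))
    exact (integral_norm_sq_error_le_trace hc hg hC hθ hp).1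
  · refine (integral_norm_sq_error_le_trace hc hg hC hθ hp.1).2 ?_
    have h := hp.2 _ hmem
    rw [cost_eq_ofReal h1, cost_eq_ofReal (integrable_norm_sq_error_of_mem_ball hg hp.1), h2,
      ENNReal.ofReal_le_ofReal_iff
        (mul_nonneg (by norm_num) (integral_nonneg fun w => by positivity))] at h
    linarith

/-- Among the estimators with finite second moments, `g` is optimal for a law with an error
independent of the observation, and it is so only up to null sets. -/
lemma cost_errorLaw_le (hg : Measurable g) (hC : C.PosSemidef) {g' : Vec m → Vec n}
    (hg' : Measurable g')
    (h : MemLp (fun w => g (obsOf w)) 2 (errorLaw g (multivariateGaussian 0 C) κ))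
    (h' : MemLp (fun w => g' (obsOf w)) 2 (errorLaw g (multivariateGaussian 0 C) κ)) :
    cost (errorLaw g (multivariateGaussian 0 C) κ) g ≤
        cost (errorLaw g (multivariateGaussian 0 C) κ) g' ∧
      (cost (errorLaw g (multivariateGaussian 0 C) κ) g' ≤
        cost (errorLaw g (multivariateGaussian 0 C) κ) g → g' =ᵐ[κ] g) := by
  obtain ⟨h1, h2⟩ := integral_norm_sq_errorLaw_self (κ := κ) hg hC
  have hd : MemLp (fun y => g y - g' y) 2 κ := by
    have hsub := h.sub h'
    rw [← errorLaw_map_obsOf (ν := multivariateGaussian 0 C) (κ := κ) hg,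
      memLp_map_measure_iff (by fun_prop) (by fun_prop)]
    exact hsub
  obtain ⟨h3, h4⟩ := integral_norm_sq_errorLaw (κ := κ) hg (memLp_two_multivariateGaussian C 0)
    integral_id_multivariateGaussian hg' hd
  rw [integral_norm_sq_multivariateGaussian hC] at h4
  have hnn : 0 ≤ ∫ y, ‖g y - g' y‖ ^ 2 ∂κ := integral_nonneg fun y => by positivity
  have htr := hC.trace_nonneg
  rw [cost_eq_ofReal h1, cost_eq_ofReal h3, h2, h4]
  refine ⟨ENNReal.ofReal_le_ofReal (by linarith), fun hle => ?_⟩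
  rw [ENNReal.ofReal_le_ofReal_iff (by linarith)] at hle
  have h0 : ∫ y, ‖g y - g' y‖ ^ 2 ∂κ = 0 := by linarith
  rw [integral_eq_zero_iff_of_nonneg (fun y => by positivity)
    (hd.integrable_norm_pow two_ne_zero)] at h0
  filter_upwards [h0] with y hy
  have : ‖g y - g' y‖ = 0 := by simpa using hy
  exact (sub_eq_zero.1 (norm_eq_zero.1 this)).symm

/-- The minimax theorem for a Gaussian error. -/
lemma isRobustEstimator_errorLaw (hc : 0 ≤ c) (hC : C.PosDef) (hθ : IsRiskParam C c θ)
    (hg : g ∈ estimators (errorLaw g (multivariateGaussian 0 C) κ) c) :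
    IsRobustEstimator (errorLaw g (multivariateGaussian 0 C) κ) c g ∧
      (∀ g', IsRobustEstimator (errorLaw g (multivariateGaussian 0 C) κ) c g' → g' =ᵐ[κ] g) ∧
      ∀ g' ∈ estimators (errorLaw g (multivariateGaussian 0 C) κ) c,
        cost (errorLaw g (multivariateGaussian 0 (inflate C θ)) κ) g ≤
          cost (errorLaw g (multivariateGaussian 0 (inflate C θ)) κ) g' := by
  have hmem := errorLaw_mem_ball (κ := κ) hg.1 hC hθ
  have hlf := (isLeastFavorable_errorLaw (κ := κ) hc hg.1 hC hθ).1
  have hopt (g' : Vec m → Vec n)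
      (hg' : g' ∈ estimators (errorLaw g (multivariateGaussian 0 C) κ) c) :=
    cost_errorLaw_le hg.1 (inflate_posDef hC hθ.2.1).posSemidef hg'.1 (hg.2 _ hmem) (hg'.2 _ hmem)
  have hle (g' : Vec m → Vec n) : cost (errorLaw g (multivariateGaussian 0 (inflate C θ)) κ) g' ≤
      worstCost (errorLaw g (multivariateGaussian 0 C) κ) c g' :=
    le_iSup₂ (f := fun p (_ : p ∈ ball (errorLaw g (multivariateGaussian 0 C) κ) c) => cost p g')
      _ hmem
  have hworst : worstCost (errorLaw g (multivariateGaussian 0 C) κ) c g ≤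
      cost (errorLaw g (multivariateGaussian 0 (inflate C θ)) κ) g :=
    iSup₂_le fun p hp => hlf.2 p hp
  have hrob : IsRobustEstimator (errorLaw g (multivariateGaussian 0 C) κ) c g :=
    ⟨hg, fun g' hg' => hworst.trans ((hopt g' hg').1.trans (hle g'))⟩
  refine ⟨hrob, fun g' hg' => ?_, fun g' hg' => (hopt g' hg').1⟩
  -- For another minimizer, cost at the least favorable law ≤ worst cost ≤ worst cost of `g` ≤ cost
  -- of `g` at that law; the equality case of the optimality of `g` applies.
  exact (hopt g' hg'.1).2 ((hle g').trans ((hg'.2 g hg).trans hworst))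

lemma memLp_mv {Ω : Type*} [MeasurableSpace Ω] {p : Measure Ω} (L : Matrix (Fin n) (Fin m) ℝ)
    {φ : Ω → Vec m} (hφ : MemLp φ 2 p) : MemLp (fun ω => mv L (φ ω)) 2 p := by
  let A : Vec m →ₗ[ℝ] Vec n :=
    { toFun := mv L
      map_add' := mv_add L
      map_smul' := fun a u => by simp [mv, Matrix.mulVec_smul] }
  exact (LinearMap.toContinuousLinearMap A).comp_memLp' hφ

lemma norm_obsOf_le (w : Joint n m) : ‖obsOf w‖ ≤ ‖w‖ := by
  rw [EuclideanSpace.norm_eq, EuclideanSpace.norm_eq, Fintype.sum_sum_type]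
  exact Real.sqrt_le_sqrt (le_add_of_nonneg_left (Finset.sum_nonneg fun i _ => by positivity))

/-- Affine functions of the observation are estimators, for a Gaussian nominal law. -/
lemma affine_mem_estimators {pnom : Measure (Joint n m)} [IsGaussian pnom] (x : Vec n) (μ : Vec m)
    (L : Matrix (Fin n) (Fin m) ℝ) : (fun y => x + mv L (y - μ)) ∈ estimators pnom c := by
  refine ⟨by fun_prop, fun p hp => ?_⟩
  have := hp.1
  obtain ⟨ε, hε, hint⟩ := IsGaussian.exists_integrable_exp_sq pnom
  have h := integrable_of_integrable_exp_of_klDiv_ne_top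
    (ne_top_of_le_ne_top ENNReal.ofReal_ne_top hp.2)
    (f := fun w => ε * ‖w‖ ^ 2) (by fun_prop) (fun w => by positivity) hint
  have h2 : Integrable (fun w : Joint n m => ‖w‖ ^ 2) p :=
    (integrable_const_mul_iff (IsUnit.mk0 _ hε.ne') _).1 h
  have hid : MemLp (id : Joint n m → Joint n m) 2 p :=
    (memLp_two_iff_integrable_sq_norm (by fun_prop)).2 h2
  have hobs : MemLp (fun w : Joint n m => obsOf w) 2 p :=
    hid.of_le (by fun_prop) (ae_of_all _ norm_obsOf_le)
  exact (memLp_const x).add (memLp_mv L (hobs.sub (memLp_const μ)))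

end GaussianError

/-! ### The Gaussian approximation as a law with an error independent of the observation -/

section Filter

variable {n m l : ℕ} {r : SigmaRule n}

lemma map_add_multivariateGaussian {C : Matrix (Fin n) (Fin n) ℝ} (hC : C.PosSemidef) (b : Vec n) :
    (multivariateGaussian 0 C).map (fun e => b + e) = multivariateGaussian b C := by
  have h := map_mv_multivariateGaussian hC (0 : Vec n) b (1 : Matrix (Fin n) (Fin n) ℝ)
  have h1 (v : Vec n) : mv 1 v = v := by simp [mv]
  simpa [h1] using h

lemma postCov_posDef (hr : r.IsStandard) (hn : 0 < n) (h : Vec n → Vec m)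
    {D : Matrix (Fin m) (Fin l) ℝ} (hD : D.rank = m) (x : Vec n) {P S : Matrix (Fin n) (Fin n) ℝ}
    (hP : P.PosDef) (hS : S * S.transpose = P) : (postCov r h D x S P).PosDef :=
  (posDef_fromBlocks_iff (sigmaCov_posDef hr h hD x S)).1 (jointCov_posDef hr hn h hD x hP hS)

lemma jointCov_add_posDef (hr : r.IsStandard) (h : Vec n → Vec m)
    {D : Matrix (Fin m) (Fin l) ℝ} (hD : D.rank = m) (x : Vec n) (S : Matrix (Fin n) (Fin n) ℝ)
    {C : Matrix (Fin n) (Fin n) ℝ} (hC : C.PosDef) :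
    (jointCov r h D x S (C +
      sigmaCross r h x S * (sigmaCov r h D x S)⁻¹ * (sigmaCross r h x S).transpose)).PosDef := by
  rw [jointCov, posDef_fromBlocks_iff (sigmaCov_posDef hr h hD x S), add_sub_cancel_right]
  exact hC

/-- Since `L K_y = K_xy` for the gain `L`, both laws of interest are instances: `C = P_{t|t}` gives
the nominal one, the inflated `C` the least favorable one. -/
lemma multivariateGaussian_jointCov_add (hr : r.IsStandard) (h : Vec n → Vec m)
    {D : Matrix (Fin m) (Fin l) ℝ} (hD : D.rank = m) (x : Vec n) (S : Matrix (Fin n) (Fin n) ℝ)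
    {C : Matrix (Fin n) (Fin n) ℝ} (hC : C.PosDef) :
    multivariateGaussian (jointMean r h x S) (jointCov r h D x S (C +
      sigmaCross r h x S * (sigmaCov r h D x S)⁻¹ * (sigmaCross r h x S).transpose)) =
    errorLaw (postMean r h D x S) (multivariateGaussian 0 C)
      (multivariateGaussian (sigmaMean r h x S) (sigmaCov r h D x S)) := by
  have hK := sigmaCov_posDef hr h hD x S
  have hKt : (sigmaCov r h D x S).transpose = sigmaCov r h D x S := by
    rw [← Matrix.conjTranspose_eq_transpose_of_trivial]; exact hK.1
  have h1 : gain r h D x S * sigmaCov r h D x S = sigmaCross r h x S :=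
    Matrix.nonsing_inv_mul_cancel_right _ _ hK.det_pos.ne'.isUnit
  have h2 : (gain r h D x S).transpose =
      (sigmaCov r h D x S)⁻¹ * (sigmaCross r h x S).transpose := by
    rw [gain, Matrix.transpose_mul, Matrix.transpose_nonsing_inv, hKt]
  have h3 := errorLaw_multivariateGaussian hC hK x (sigmaMean r h x S) (gain r h D x S)
  rw [h1, h2, ← Matrix.mul_assoc] at h3
  exact h3.symm

lemma condDistrib_of_eq_errorLaw {p : Measure (Joint n m)} [IsFiniteMeasure p]
    {g : Vec m → Vec n} (hg : Measurable g) {C : Matrix (Fin n) (Fin n) ℝ} (hC : C.PosSemidef)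
    {κ : Measure (Vec m)} [IsProbabilityMeasure κ]
    (hp : p = errorLaw g (multivariateGaussian 0 C) κ) :
    ∀ᵐ y ∂(p.map obsOf), condDistrib stateOf obsOf p y = multivariateGaussian (g y) C := by
  subst hp
  filter_upwards [condDistrib_errorLaw (ν := multivariateGaussian 0 C) (κ := κ) hg] with y hy
  rw [hy, map_add_multivariateGaussian hC]

end Filter

end UpdateResilient

end

open UpdateResilient
theorem theorem2 {n m : ℕ} (hn : 0 < n)
    (r : SigmaRule n) (hr : r.IsStandard)
    (f : Vec n → Vec n) (h : Vec n → Vec m)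
    (B : Matrix (Fin n) (Fin (n + m)) ℝ) (D : Matrix (Fin m) (Fin (n + m)) ℝ)
    (hB : B.rank = n) (hD : D.rank = m)
    (x : Vec n) (P S : Matrix (Fin n) (Fin n) ℝ) (hP : P.PosDef) (hS : S * S.transpose = P)
    (c : ℝ) (hc : 0 ≤ c) :
    -- the second-moment identity and the nondegeneracy of the Gaussian approximation
    (r ≠ SigmaRule.gaussHermite n 1 → r.secondMoment = 1) ∧
    (jointCov r h D x S P).PosDef ∧
    -- the robust estimator: it solves the minimax problem, uniquely up to null sets
    IsRobustEstimator (nominalLaw r h D x S P) c (postMean r h D x S) ∧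
    (∀ g, IsRobustEstimator (nominalLaw r h D x S P) c g → g =ᵐ[volume] postMean r h D x S) ∧
    -- the nominal error covariance
    (postCov r h D x S P).PosDef ∧
    HasErrorCov (nominalLaw r h D x S P) (postMean r h D x S) (postCov r h D x S P) ∧
    -- the risk sensitivity parameter
    ∃ θ : ℝ, IsRiskParam (postCov r h D x S P) c θ ∧
      (∀ θ', IsRiskParam (postCov r h D x S P) c θ' → θ' = θ) ∧ (0 < c → 0 < θ) ∧
      (inflate (postCov r h D x S P) θ).PosDef ∧ (leastFavorableCov r h D x S P θ).PosDef ∧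
      -- the least favorable law, which forms a saddle point with the estimator
      IsLeastFavorable (nominalLaw r h D x S P) c (postMean r h D x S)
        (leastFavorableLaw r h D x S P θ) ∧
      (∀ p, IsLeastFavorable (nominalLaw r h D x S P) c (postMean r h D x S) p →
        p = leastFavorableLaw r h D x S P θ) ∧
      (∀ g ∈ estimators (nominalLaw r h D x S P) c,
        cost (leastFavorableLaw r h D x S P θ) (postMean r h D x S) ≤
          cost (leastFavorableLaw r h D x S P θ) g) ∧
      -- the least favorable error covariance
      HasErrorCov (leastFavorableLaw r h D x S P θ) (postMean r h D x S)
        (inflate (postCov r h D x S P) θ) ∧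
      -- the least favorable law of the state given the observation
      (∀ᵐ y ∂((leastFavorableLaw r h D x S P θ).map obsOf),
        condDistrib stateOf obsOf (leastFavorableLaw r h D x S P θ) y =
          multivariateGaussian (postMean r h D x S y) (inflate (postCov r h D x S P) θ)) ∧
      -- the sigma-point approximation of the least favorable a priori law at the next stage
      ∀ S' : Matrix (Fin n) (Fin n) ℝ, S' * S'.transpose = inflate (postCov r h D x S P) θ →
        (∀ y, (sigmaCov r f B (postMean r h D x S y) S').PosDef) ∧
        ∀ᵐ y ∂((leastFavorableLaw r h D x S P θ).map obsOf),
          IsSigmaPrediction r f B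
            (condDistrib stateOf obsOf (leastFavorableLaw r h D x S P θ) y)
            (multivariateGaussian (sigmaMean r f (postMean r h D x S y) S')
              (sigmaCov r f B (postMean r h D x S y) S')) := by
  have hK := sigmaCov_posDef hr h hD x S
  have hC := postCov_posDef hr hn h hD x hP hS
  -- Puts the nominal covariance in the same form as the least favorable one, with the Schur
  -- complement in the role of `C`.
  have hPC : P = postCov r h D x S P +
      sigmaCross r h x S * (sigmaCov r h D x S)⁻¹ * (sigmaCross r h x S).transpose :=
    (sub_add_cancel _ _).symm
  have hnom : nominalLaw r h D x S P =
      errorLaw (postMean r h D x S) (multivariateGaussian 0 (postCov r h D x S P))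
        (multivariateGaussian (sigmaMean r h x S) (sigmaCov r h D x S)) := by
    rw [← multivariateGaussian_jointCov_add hr h hD x S hC, ← hPC]
  have hg : postMean r h D x S ∈ estimators (nominalLaw r h D x S P) c :=
    affine_mem_estimators x (sigmaMean r h x S) (gain r h D x S)
  have hgm := hg.1
  obtain ⟨θ, hθ⟩ := exists_isRiskParam hn hC hc
  have hCθ := inflate_posDef hC hθ.2.1
  have hlf : leastFavorableLaw r h D x S P θ =
      errorLaw (postMean r h D x S) (multivariateGaussian 0 (inflate (postCov r h D x S P) θ))
        (multivariateGaussian (sigmaMean r h x S) (sigmaCov r h D x S)) :=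
    multivariateGaussian_jointCov_add hr h hD x S hCθ
  rw [hnom] at hg ⊢
  obtain ⟨hrob, huniq, hsaddle⟩ := isRobustEstimator_errorLaw hc hC hθ hg
  obtain ⟨hleast, hleast'⟩ := isLeastFavorable_errorLaw
    (κ := multivariateGaussian (sigmaMean r h x S) (sigmaCov r h D x S)) hc hgm hC hθ
  refine ⟨hr.secondMoment_eq_one hn, jointCov_posDef hr hn h hD x hP hS, hrob,
    fun g hg' => (volume_absolutelyContinuous_multivariateGaussian hK _).ae_le (huniq g hg'), hC,
    hasErrorCov_errorLaw hgm hC.posSemidef, θ, hθ, fun θ' hθ' => isRiskParam_unique hn hC hθ' hθ,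
    hθ.pos, hCθ, jointCov_add_posDef hr h hD x S hCθ, hlf ▸ hleast, hlf ▸ hleast', hlf ▸ hsaddle,
    hlf ▸ hasErrorCov_errorLaw hgm hCθ.posSemidef,
    condDistrib_of_eq_errorLaw hgm hCθ.posSemidef hlf, fun S' hS' =>
    ⟨fun y => sigmaCov_posDef hr f hB _ _, ?_⟩⟩
  filter_upwards [condDistrib_of_eq_errorLaw hgm hCθ.posSemidef hlf] with y hy
  -- The mean and the covariance matrix are those of the conditional law identified by `hy`.
  exact ⟨_, _, S', hCθ, hS', hy, rfl⟩
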